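/- Let $V=\mathbb C^n$ and let $W\subset GL(V)$ be a finite reflection group, i.e. a finite group generated by elements whose fixed space in $V$ is a hyperplane. Write $S=S(V^*)=\mathbb C[x_1,\dots,x_n]$, with $W$ acting through the dual action on $V^*$, and let $S^W$ be the ring of invariants. For a finite-dimensional $W$-representation $U$, the $U$-exponents of $W$ are the polynomial degrees $e_1(U)\le\dots\le e_{\dim U}(U)$ of a homogeneous basis of the $S^W$-module $(S\otimes U)^W$, and $\psi(U)=\sum_i e_i(U)$. Let $N$ be the number of reflections in $W$ and $N^*$ the number of reflecting hyperplanes of $W$. (a) For all integers $k,r\ge 0$ and $U=\wedge^kV^*\otimes\wedge^rV$, the $S^W$-module $(S\otimes U)^W$ has a homogeneous basis with $\dim U$ elements, and the sum of the degrees of any homogeneous basis is $$\psi(U)=\binom{n-1}{k-1}\binom{n-1}{r}N+\binom{n-1}{k}\binom{n-1}{r-1}N^*,\qquad\text{where }\tbinom{m}{-1}=0.$$ (b) Let $f_1,\dots,f_n$ be basic invariants of $W$ (homogeneous, algebraically independent generators of $S^W$) of degrees $d_1\le\dots\le d_n$, put $e_i=d_i-1$, and let $e_1^*\le\dots\le e_n^*$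 be the $V$-exponents of $W$. Suppose that $W$ is irreducible and a duality group, i.e. $e_i+e^*_{n+1-i}=d_n$ for all $i$. Let $0\le k,r\le n$ and $U=\wedge^kV^*\otimes\wedge^rV$. (b1) Let $F_{k,r}(q)$ be the coefficient of $t^ks^r$ in $$\sum_{r=0}^n s^r\,\sigma_r(q^{e_1^*},\dots,q^{e_n^*})\,\frac{\prod_{i=1}^r(1+q^{-e_i^*}t)\,\prod_{i=1}^{n-r}(1+q^{e_i}t)}{\prod_{i=1}^n(1-q^{d_i})},$$ where $\sigma_r$ is the $r$-th elementary symmetric function. Then the degree sum that this product formula predicts, when taken as the Hilbert series of $(S\otimes\wedge V^*\otimes\wedge V)^W$, is $\psi(U)$: $$\lim_{q\to1}\frac{d}{dq}\Big(F_{k,r}(q)\cdot\prod_{i=1}^n(1-q^{d_i})\Big)=\psi(U).$$ (b2) Let $\theta_1,\dots,\theta_n$ be a homogeneous $S^W$-basis of $(S\otimes V)^W$, with $\theta_i$ of degree $e_i^*$. Put $df=\sum_i\frac{\partial f}{\partial x_i}\otimes x_i$. For $\theta=\sum_jh_j\otimes y_j$, where $y_1,\dots,y_n$ is the basis of $V$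 dual to $x_1,\dots,x_n$, put $$\tilde\theta(f\otimes\eta\otimes\eta')=\sum_j\overline{h_j}\big(\tfrac{\partial}{\partial x_1},\dots,\tfrac{\partial}{\partial x_n}\big)(f)\otimes(x_j\wedge\eta)\otimes\eta'$$ on $S\otimes\wedge V^*\otimes\wedge V$, the bar being complex conjugation of coefficients. Consider the conjectured basis elements $df_L\cdot\tilde\theta_I(\theta_J)$ of $(S\otimes U)^W$, indexed by the triples of subsets $J\subseteq\{1,\dots,n\}$, $I\subseteq\{1,\dots,r\}$, $L\subseteq\{1,\dots,n-r\}$ with $|J|=r$ and $|I|+|L|=k$; here $df_L=\bigwedge_{l\in L}df_l$, $\theta_J=\bigwedge_{j\in J}\theta_j$, and $\tilde\theta_I$ is the composite of the $\tilde\theta_i$, $i\in I$, all in increasing order of indices. Each of these elements lies in $S\otimes\wedge^kV^*\otimes\wedge^rV$ and is homogeneous of polynomial degree $\sum_{l\in L}e_l+\sum_{j\in J}e^*_j-\sum_{i\in I}e^*_i$ (so it is $0$ if this number is negative), and the sum of these degrees over all triples $(I,J,L)$ is $\psi(U)$. -/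

import Mathlib

open scoped TensorProduct

noncomputable section

namespace ReflInv

/-- The space `V = ℂⁿ`. -/
abbrev V (n : ℕ) := Fin n → ℂ

/-- The symmetric algebra `S(V*) = ℂ[x₁,…,xₙ]`; the variable `X i` is the `i`-th coordinate
function on `V = ℂⁿ`. -/
abbrev S (n : ℕ) := MvPolynomial (Fin n) ℂ

/-- The general linear group of `V = ℂⁿ`. -/
abbrev GLV (n : ℕ) := LinearMap.GeneralLinearGroup ℂ (V n)

/-! ### Reflection groups -/

/-- The fixed space of `g` in `V`. -/
def fixedSpace {n : ℕ} (g : GLV n) : Submodule ℂ (V n) :=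
  LinearMap.ker ((g : Module.End ℂ (V n)) - 1)

/-- A reflection: the fixed space is a hyperplane (codimension exactly one). -/
def IsReflection {n : ℕ} (g : GLV n) : Prop :=
  Module.finrank ℂ (fixedSpace g) + 1 = n

/-- A (finite) reflection group is a finite group generated by the reflections it contains. -/
def IsReflectionGroup {n : ℕ} (W : Subgroup (GLV n)) : Prop :=
  Finite W ∧ Subgroup.closure {g : GLV n | g ∈ W ∧ IsReflection g} = W

/-- `N`: the number of reflections in `W`. -/
def numReflections {n : ℕ} (W : Subgroup (GLV n)) : ℕ :=
  {g : GLV n | g ∈ W ∧ IsReflection g}.ncard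

/-- `N*`: the number of reflecting hyperplanes of `W`. -/
def numHyperplanes {n : ℕ} (W : Subgroup (GLV n)) : ℕ :=
  (fixedSpace '' {g : GLV n | g ∈ W ∧ IsReflection g}).ncard

/-- The tautological representation of `W` on `V`. -/
def stdRep {n : ℕ} (W : Subgroup (GLV n)) : Representation ℂ W (V n) :=
  (Units.coeHom (Module.End ℂ (V n))).comp W.subtype

/-! ### The action on polynomials and the invariant ring -/

/-- The action of `g` on `S(V*)` induced by the dual action on `V*`: the polynomial function `f`
is sent to `f ∘ g⁻¹`, so `xᵢ` goes to `∑ⱼ (g⁻¹)ᵢⱼ xⱼ`. -/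
def polyAct {n : ℕ} (g : GLV n) : S n →ₐ[ℂ] S n :=
  MvPolynomial.aeval fun i =>
    ∑ j, MvPolynomial.C (((g⁻¹ : GLV n) : Module.End ℂ (V n)) (Pi.single j 1) i) *
      MvPolynomial.X j

lemma polyAct_one {n : ℕ} : polyAct (1 : GLV n) = AlgHom.id ℂ (S n) := by
  apply MvPolynomial.algHom_ext
  intro i
  simp [polyAct, Pi.single_apply]

lemma polyAct_mul {n : ℕ} (g h : GLV n) : polyAct (g * h) = (polyAct g).comp (polyAct h) := by
  apply MvPolynomial.algHom_ext
  intro i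
  have key : ∀ k, (((g * h)⁻¹ : GLV n) : Module.End ℂ (V n)) (Pi.single k 1) i =
      ∑ j, ((h⁻¹ : GLV n) : Module.End ℂ (V n)) (Pi.single j 1) i *
        ((g⁻¹ : GLV n) : Module.End ℂ (V n)) (Pi.single k 1) j := by
    intro k
    rw [mul_inv_rev, Units.val_mul, Module.End.mul_apply]
    conv_lhs => rw [LinearMap.pi_apply_eq_sum_univ ((h⁻¹ : GLV n) : Module.End ℂ (V n))]
    rw [Finset.sum_apply]
    refine Finset.sum_congr rfl fun j _ => ?_
    rw [Pi.smul_apply, smul_eq_mul, mul_comm]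
    congr 3
    refine congrFun (congrArg _ (funext fun l => ?_)) i
    simp [Pi.single_apply, eq_comm]
  simp only [polyAct, AlgHom.comp_apply, MvPolynomial.aeval_X, map_sum, map_mul,
    MvPolynomial.algHom_C, MvPolynomial.algebraMap_eq]
  simp only [Finset.mul_sum]
  rw [Finset.sum_comm]
  refine Finset.sum_congr rfl fun k _ => ?_
  have h2 := key k
  rw [h2, map_sum, Finset.sum_mul]
  refine Finset.sum_congr rfl fun j _ => ?_
  rw [map_mul, mul_assoc]

/-- The representation of `W` on `S(V*)`. -/
def polyRep {n : ℕ} (W : Subgroup (GLV n)) : Representation ℂ W (S n) where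
  toFun w := (polyAct (w : GLV n)).toLinearMap
  map_one' := by
    rw [Subgroup.coe_one, polyAct_one]; rfl
  map_mul' w w' := by
    rw [Subgroup.coe_mul, polyAct_mul]; rfl

/-- The invariant ring `S(V*)^W`. -/
def invRing {n : ℕ} (W : Subgroup (GLV n)) : Subalgebra ℂ (S n) where
  carrier := {f | ∀ w ∈ W, polyAct w f = f}
  mul_mem' hf hg w hw := by rw [map_mul, hf w hw, hg w hw]
  add_mem' hf hg w hw := by rw [map_add, hf w hw, hg w hw]
  algebraMap_mem' c w _ := (polyAct w).commutes c

section Representations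

variable {U : Type} [AddCommMonoid U] [Module ℂ U]

lemma polyRep_tprod_smul {n : ℕ} (W : Subgroup (GLV n)) (ρ : Representation ℂ W U) (w : W)
    (f : S n) (t : S n ⊗[ℂ] U) :
    ((polyRep W).tprod ρ) w (f • t) = polyAct (w : GLV n) f • ((polyRep W).tprod ρ) w t := by
  induction t using TensorProduct.induction_on with
  | zero => simp
  | tmul g u =>
    simp [TensorProduct.smul_tmul', polyRep]
  | add a b ha hb => rw [smul_add, map_add, ha, hb, map_add, smul_add]

/-- The `W`-fixed space `(S(V*) ⊗ U)^W` for the diagonal action, as a module over `S(V*)^W` by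
multiplication into the left tensor factor. -/
def invTensor {n : ℕ} (W : Subgroup (GLV n)) (ρ : Representation ℂ W U) :
    Submodule (invRing W) (S n ⊗[ℂ] U) where
  carrier := {t | ∀ w : W, ((polyRep W).tprod ρ) w t = t}
  add_mem' hs ht w := by rw [map_add, hs w, ht w]
  zero_mem' w := map_zero _
  smul_mem' f t ht w := by
    change ((polyRep W).tprod ρ) w ((f : S n) • t) = (f : S n) • t
    rw [polyRep_tprod_smul, ht w, f.2 w w.2]

instance {n : ℕ} (W : Subgroup (GLV n)) (ρ : Representation ℂ W U) :
    Module (invRing W) (invTensor W ρ) :=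
  (invTensor W ρ).module

/-- The homogeneous component `S^d(V*) ⊗ U` of `S(V*) ⊗ U`. -/
def tensorPiece (n : ℕ) (U : Type) [AddCommMonoid U] [Module ℂ U] (d : ℕ) :
    Submodule ℂ (S n ⊗[ℂ] U) :=
  LinearMap.range ((MvPolynomial.homogeneousSubmodule (Fin n) ℂ d).subtype.rTensor U)

/-- The family `b` is a homogeneous basis of the `S(V*)^W`-module `(S(V*) ⊗ U)^W`, and `b i` has
polynomial degree `d i`. -/
def IsHomogeneousBasis {n m : ℕ} (W : Subgroup (GLV n)) (ρ : Representation ℂ W U)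
    (b : Fin m → S n ⊗[ℂ] U) (d : Fin m → ℕ) : Prop :=
  (∃ B : Module.Basis (Fin m) (invRing W) (invTensor W ρ), ∀ i, (B i : S n ⊗[ℂ] U) = b i) ∧
    ∀ i, b i ∈ tensorPiece n U (d i)

/-- `d 0 ≤ d 1 ≤ ⋯` are the `U`-exponents of `W`: the degrees, in weakly increasing order, of a
homogeneous basis of `(S(V*) ⊗ U)^W` over `S(V*)^W`. -/
def IsUExponents {n m : ℕ} (W : Subgroup (GLV n)) (ρ : Representation ℂ W U)
    (d : Fin m → ℕ) : Prop :=
  Monotone d ∧ ∃ b : Fin m → S n ⊗[ℂ] U, IsHomogeneousBasis W ρ b d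

/-- `ψ(U) = p`: the module `(S(V*) ⊗ U)^W` has a homogeneous basis over `S(V*)^W` with `dim U`
elements (so that there are `dim U` many `U`-exponents), and the degrees of every homogeneous
basis add up to `p`. -/
def SumOfUExponentsIs {n : ℕ} (W : Subgroup (GLV n)) (ρ : Representation ℂ W U) (p : ℕ) : Prop :=
  (∃ d : Fin (Module.finrank ℂ U) → ℕ, IsUExponents W ρ d) ∧
    ∀ (m : ℕ) (b : Fin m → S n ⊗[ℂ] U) (d : Fin m → ℕ), IsHomogeneousBasis W ρ b d →
      ∑ i, d i = p

end Representations

/-- The `k`-th exterior power of a representation. -/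
def extPow {U : Type} [AddCommGroup U] [Module ℂ U] {G : Type} [Group G] (ρ : Representation ℂ G U) (k : ℕ) :
    Representation ℂ G (⋀[ℂ]^k U) where
  toFun g := exteriorPower.map k (ρ g)
  map_one' := by rw [map_one]; exact exteriorPower.map_id
  map_mul' g h := by
    rw [map_mul, Module.End.mul_eq_comp, Module.End.mul_eq_comp]
    exact exteriorPower.map_comp (ρ h) (ρ g)

/-- The representation `∧^k V* ⊗ ∧^r V` of `W`. -/
def mixedRep {n : ℕ} (W : Subgroup (GLV n)) (k r : ℕ) :
    Representation ℂ W ((⋀[ℂ]^k (Module.Dual ℂ (V n))) ⊗[ℂ] (⋀[ℂ]^r (V n))) :=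
  (extPow (stdRep W).dual k).tprod (extPow (stdRep W) r)

/-! ### Exponents, coexponents and duality groups -/

/-- `f` is a system of basic invariants of `W`, of degrees `d`: homogeneous algebraically
independent polynomials that generate `S(V*)^W`. -/
def IsBasicInvariants {n : ℕ} (W : Subgroup (GLV n)) (f : Fin n → S n) (d : Fin n → ℕ) : Prop :=
  (∀ i, (f i).IsHomogeneous (d i)) ∧ AlgebraicIndependent ℂ f ∧
    Algebra.adjoin ℂ (Set.range f) = invRing W

/-- `θ` is a set of basic derivations of `W`, `θ i` having polynomial degree `d i`. -/
def IsBasicDerivations {n : ℕ} (W : Subgroup (GLV n)) (θ : Fin n → S n ⊗[ℂ] V n)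
    (d : Fin n → ℕ) : Prop :=
  IsHomogeneousBasis W (stdRep W) θ d

/-- `e 0 ≤ ⋯ ≤ e (n-1)` are the exponents of `W`: the degrees of basic invariants minus one. -/
def IsExponents {n : ℕ} (W : Subgroup (GLV n)) (e : Fin n → ℕ) : Prop :=
  Monotone e ∧ ∃ f : Fin n → S n, IsBasicInvariants W f fun i => e i + 1

/-- `c 0 ≤ ⋯ ≤ c (n-1)` are the coexponents of `W`, that is, its `V`-exponents. -/
def IsCoexponents {n : ℕ} (W : Subgroup (GLV n)) (c : Fin n → ℕ) : Prop :=
  IsUExponents W (stdRep W) c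

/-- `W` is a duality group with exponents `e` and coexponents `c`, i.e.
`e_i + e*_{n+1-i} = h`, the largest degree. (`Fin.rev` is the reversal of the index set.) -/
def IsDualityGroup {n : ℕ} (W : Subgroup (GLV n)) (e c : Fin n → ℕ) : Prop :=
  IsReflectionGroup W ∧ IsExponents W e ∧ IsCoexponents W c ∧
    ∀ i, e i + c i.rev = Finset.univ.sup fun j => e j + 1

/-! ### The product formula -/

/-- The first `r` indices of `Fin n`. -/
def firstIdx (n r : ℕ) : Finset (Fin n) := Finset.univ.filter fun i => (i : ℕ) < r

/-- The elementary symmetric function `σ_r` of `y 0, …, y (n-1)`. -/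
def sigma {n : ℕ} (r : ℕ) (y : Fin n → ℝ) : ℝ :=
  ∑ J ∈ Finset.univ.powersetCard r, ∏ j ∈ J, y j

/-- The polynomial in `t`
`σ_r(q^{e*_1},…,q^{e*_n}) ∏_{i=1}^{r} (1 + q^{-e*_i} t) ∏_{i=1}^{n-r} (1 + q^{e_i} t)`;
divided by `∏ᵢ (1 - q^{d_i})`, the inverse of the Hilbert series of `S(V*)^W`, it is the coefficient
of `s^r` in the product formula for the Hilbert series of `(S(V*) ⊗ ∧V* ⊗ ∧V)^W`. -/
def formulaNumerator {n : ℕ} (e c : Fin n → ℕ) (r : ℕ) (q : ℝ) : Polynomial ℝ :=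
  Polynomial.C (sigma r fun i => q ^ c i) *
    (∏ i ∈ firstIdx n r, (1 + Polynomial.C ((q ^ c i)⁻¹) * Polynomial.X)) *
    ∏ i ∈ firstIdx n (n - r), (1 + Polynomial.C (q ^ e i) * Polynomial.X)

/-- The coefficient of `s^r t^k` in the product formula for the Hilbert series of
`(S(V*) ⊗ ∧V* ⊗ ∧V)^W`. -/
def formulaCoeff {n : ℕ} (e c : Fin n → ℕ) (k r : ℕ) (q : ℝ) : ℝ :=
  (formulaNumerator e c r q).coeff k / ∏ i, (1 - q ^ (e i + 1))

/-- The Hilbert series `∏ᵢ 1 / (1 - q^{d_i})` of `S(V*)^W`, with `d_i = e_i + 1`. -/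
def hilbInvRing {n : ℕ} (e : Fin n → ℕ) (q : ℝ) : ℝ :=
  1 / ∏ i, (1 - q ^ (e i + 1))

/-! ### The conjectural basis -/

/-- `S(V*) ⊗ ∧V* ⊗ ∧V`, with the componentwise product. -/
abbrev Omega (n : ℕ) :=
  S n ⊗[ℂ] (ExteriorAlgebra ℂ (Module.Dual ℂ (V n)) ⊗[ℂ] ExteriorAlgebra ℂ (V n))

/-- The component `S^m(V*) ⊗ ∧^k V* ⊗ ∧^r V` of `S(V*) ⊗ ∧V* ⊗ ∧V`. -/
def omegaPiece (n m k r : ℕ) : Submodule ℂ (Omega n) :=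
  LinearMap.range (TensorProduct.map (MvPolynomial.homogeneousSubmodule (Fin n) ℂ m).subtype
    (TensorProduct.map (⋀[ℂ]^k (Module.Dual ℂ (V n))).subtype (⋀[ℂ]^r (V n)).subtype))

/-- The coordinate function `x_i` as an element of `∧V*`. -/
def extX {n : ℕ} (i : Fin n) : ExteriorAlgebra ℂ (Module.Dual ℂ (V n)) :=
  ExteriorAlgebra.ι ℂ (LinearMap.proj i : V n →ₗ[ℂ] ℂ)

/-- `df = ∑ᵢ ∂f/∂xᵢ ⊗ xᵢ ⊗ 1`. -/
def diff {n : ℕ} (f : S n) : Omega n :=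
  ∑ i, MvPolynomial.pderiv i f ⊗ₜ[ℂ] (extX i ⊗ₜ[ℂ] 1)

/-- The inclusion of `S(V*) ⊗ V` into `S(V*) ⊗ ∧V* ⊗ ∧V`. -/
def derToOmega {n : ℕ} : S n ⊗[ℂ] V n →ₗ[ℂ] Omega n :=
  LinearMap.lTensor (S n)
    ((TensorProduct.mk ℂ (ExteriorAlgebra ℂ (Module.Dual ℂ (V n))) (ExteriorAlgebra ℂ (V n)) 1) ∘ₗ
      ExteriorAlgebra.ι ℂ)

/-- The coefficient `h_j` of a derivation `∑ⱼ h_j ⊗ y_j`. -/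
def derCoeff {n : ℕ} (θ : S n ⊗[ℂ] V n) (j : Fin n) : S n :=
  TensorProduct.rid ℂ (S n) (LinearMap.lTensor (S n) (LinearMap.proj j : V n →ₗ[ℂ] ℂ) θ)

/-- The constant coefficient differential operator `∏ᵢ (∂/∂xᵢ)^{aᵢ}`. -/
def monomialDeriv {n : ℕ} (a : Fin n →₀ ℕ) : Module.End ℂ (S n) :=
  ((List.finRange n).map fun i =>
    ((MvPolynomial.pderiv i).toLinearMap : Module.End ℂ (S n)) ^ a i).prod

/-- The differential operator `h̄(∂/∂x₁,…,∂/∂xₙ)`, the bar being conjugation of coefficients. -/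
def conjDiffOp {n : ℕ} (h : S n) : Module.End ℂ (S n) :=
  ∑ a ∈ h.support, (starRingEnd ℂ) (h.coeff a) • monomialDeriv a

/-- The operator `θ̃` attached to a derivation `θ = ∑ⱼ h_j ⊗ y_j`:
`f ⊗ η ⊗ η' ↦ ∑ⱼ h̄_j(∂/∂x₁,…,∂/∂xₙ)(f) ⊗ (x_j ∧ η) ⊗ η'`. -/
def tildeOp {n : ℕ} (θ : S n ⊗[ℂ] V n) : Module.End ℂ (Omega n) :=
  ∑ j, TensorProduct.map (conjDiffOp (derCoeff θ j))
    (TensorProduct.map (LinearMap.mulLeft ℂ (extX j)) LinearMap.id)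

/-- The alleged basis element `df_L · θ̃_I (θ_J)`. -/
def basisElement {n : ℕ} (f : Fin n → S n) (θ : Fin n → S n ⊗[ℂ] V n)
    (I J L : Finset (Fin n)) : Omega n :=
  (L.sort.map fun l => diff (f l)).prod *
    (I.sort.map fun i => tildeOp (θ i)).prod (J.sort.map fun j => derToOmega (θ j)).prod

/-- The index set of the conjectural basis of `(S(V*) ⊗ ∧^k V* ⊗ ∧^r V)^W`: triples `(I, J, L)`
with `J ⊆ [n]`, `I ⊆ [r]`, `L ⊆ [n-r]`, `|J| = r` and `|I| + |L| = k`. -/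
def basisIndex (n k r : ℕ) : Finset (Finset (Fin n) × Finset (Fin n) × Finset (Fin n)) :=
  Finset.univ.filter fun T => T.1 ⊆ firstIdx n r ∧ T.2.2 ⊆ firstIdx n (n - r) ∧
    T.2.1.card = r ∧ T.1.card + T.2.2.card = k

/-- The polynomial degree `∑_{l ∈ L} e_l + ∑_{j ∈ J} e*_j - ∑_{i ∈ I} e*_i` of `df_L · θ̃_I (θ_J)`. -/
def basisDegree {n : ℕ} (e c : Fin n → ℕ) (I J L : Finset (Fin n)) : ℤ :=
  ∑ l ∈ L, (e l : ℤ) + ∑ j ∈ J, (c j : ℤ) - ∑ i ∈ I, (c i : ℤ)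

/-- An element of `S(V*) ⊗ ∧^k V* ⊗ ∧^r V` homogeneous of polynomial degree `δ ∈ ℤ`; there is only
the zero element when `δ` is negative. -/
def IsHomogeneousOmega {n : ℕ} (k r : ℕ) (δ : ℤ) (ω : Omega n) : Prop :=
  ω = 0 ∨ ∃ m : ℕ, (m : ℤ) = δ ∧ ω ∈ omegaPiece n m k r

/-- The binomial coefficient `a choose (b - 1)`, which is `0` for `b = 0`. -/
def choosePred (a b : ℕ) : ℕ := if b = 0 then 0 else a.choose (b - 1)

end ReflInv

end

/-!
The degree sum `ψ(U)` is read off from Molien's formula, for every finite-dimensional representation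
`U` of a finite reflection group `W`.

*Freeness.* The module `(S(V*) ⊗ U)^W` is free over `S(V*)^W` by Chevalley's argument, applied with
coefficients in `U`. The divided difference operators `α⁻¹ (s - 1)` of the reflections lower the
degree, are linear over the invariants and preserve ideals generated by invariants. By induction on
the degree, a relation between homogeneous polynomials with invariant coefficients becomes, after
application of a linear functional to the coefficients, a relation modulo the ideal generated by the
invariants of positive degree (`sum_smul_mem_positiveIdeal`). Hence homogeneous elements of
`(S(V*) ⊗ U)^W` that form a `ℂ`-basis modulo `S(V*)^W_+ · (S(V*) ⊗ U)^W` are linearly independent over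
`S(V*)^W`, and they span by graded Nakayama (`exists_isUExponents`).

*Degree sums.* For a homogeneous basis of degrees `d i` put `P = ∑ X ^ d i`. The Hilbert series of
`(S(V*) ⊗ U)^W` is `P` times that of `S(V*)^W`, so that Molien's formula for both series gives
`∑_w (tr_U w - P) / det (1 - X w⁻¹) = 0`. The identity of `W` contributes the pole of order `n` at
`X = 1`, and the reflections contribute those of order `n - 1`. Comparing the two leading
coefficients yields `P(1) = dim U` and
`∑ d i = ∑_s (dim U - tr_U s) / (1 - (det s)⁻¹)`, the sum being over the reflections
(`IsHomogeneousBasis.card_and_sum_degrees`). For `U = ∧^k V* ⊗ ∧^r V` the traces at a reflection are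
polynomials in `det s` and `(det s)⁻¹`, each summand is
`C(n-1,k-1) C(n-1,r) - C(n-1,k) C(n-1,r-1) det s`, and the determinants of the reflections with a given
hyperplane add up to `-1`; this is the formula for `ψ` (`sumOfUExponentsIs_mixedRep`). The case `U = V`
gives `∑ e*_i = N*`, and Molien's formula for `S(V*)^W` itself gives `∑ e_i = N`.

*The product formula and the triples.* For `q ≠ 0` the coefficient of `t^k s^r` in the numerator of the
product formula expands into `∑ q ^ deg` over the triples `(I, J, L)`, so that its derivative tends to
the sum of the degrees of the triples as `q → 1` (`tendsto_deriv_formulaCoeff`). That sum is computed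
by counting: the pairs `(I, L)` are the `k`-subsets of an `n`-element set, of total weight `N - r h` by
duality, and `N + N* = n h` (`sum_basisDegree`). The homogeneity of `df_L · θ̃_I (θ_J)` is a
bookkeeping of degrees, in which `θ̃_i` lowers the polynomial degree by `e*_i`
(`isHomogeneousOmega_basisElement`).
-/

noncomputable section

namespace ReflInv

/-! ### Grading and group action on `S(V*)` and `S(V*) ⊗ U` -/

lemma isHomogeneous_polyAct {n : ℕ} (g : GLV n) {f : S n} {d : ℕ} (hf : f.IsHomogeneous d) :
    (polyAct g f).IsHomogeneous d := by
  have h := hf.aeval (n := 1) (fun i => ∑ j, MvPolynomial.C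
    (((g⁻¹ : GLV n) : Module.End ℂ (V n)) (Pi.single j 1) i) * MvPolynomial.X j) fun i =>
      MvPolynomial.IsHomogeneous.sum _ _ _ fun j _ => MvPolynomial.isHomogeneous_C_mul_X _ _
  rwa [one_mul] at h

lemma homogeneousComponent_mul_of_isHomogeneous {n : ℕ} (f : S n) {p : S n} {e : ℕ}
    (hp : p.IsHomogeneous e) (D : ℕ) :
    MvPolynomial.homogeneousComponent D (f * p) =
      if e ≤ D then MvPolynomial.homogeneousComponent (D - e) f * p else 0 := by
  induction f using MvPolynomial.induction_on' with
  | monomial u a =>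
    have h1 : (MvPolynomial.monomial u a : S n).IsHomogeneous u.degree :=
      MvPolynomial.isHomogeneous_monomial a rfl
    rw [MvPolynomial.homogeneousComponent_of_mem (h1.mul hp),
      MvPolynomial.homogeneousComponent_of_mem h1]
    by_cases h : e ≤ D
    · by_cases h' : D - e = u.degree
      · rw [if_pos (by omega), if_pos h, if_pos h']
      · rw [if_neg (by omega), if_pos h, if_neg h', zero_mul]
    · rw [if_neg (by omega), if_neg h]
  | add p q hp hq =>
    rw [add_mul, map_add, hp, hq]
    split_ifs
    · rw [map_add, add_mul]
    · rw [add_zero]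

lemma homogeneousComponent_polyAct {n : ℕ} (g : GLV n) (f : S n) (d : ℕ) :
    MvPolynomial.homogeneousComponent d (polyAct g f) =
      polyAct g (MvPolynomial.homogeneousComponent d f) := by
  induction f using MvPolynomial.induction_on' with
  | monomial u a =>
    have h1 : (MvPolynomial.monomial u a : S n).IsHomogeneous u.degree :=
      MvPolynomial.isHomogeneous_monomial a rfl
    rw [MvPolynomial.homogeneousComponent_of_mem (isHomogeneous_polyAct g h1),
      MvPolynomial.homogeneousComponent_of_mem h1]
    split_ifs <;> simp
  | add p q hp hq => rw [map_add, map_add, hp, hq, map_add, map_add]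

lemma homogeneousComponent_mem_invRing {n : ℕ} {W : Subgroup (GLV n)} {f : S n}
    (hf : f ∈ invRing W) (d : ℕ) : MvPolynomial.homogeneousComponent d f ∈ invRing W := by
  intro w hw
  rw [← homogeneousComponent_polyAct, hf w hw]

section TensorGrading

variable {U : Type} [AddCommGroup U] [Module ℂ U] {n : ℕ}

/-- The projection of `S(V*) ⊗ U` onto its homogeneous component of polynomial degree `d`. -/
def tensorComponent (n : ℕ) (U : Type) [AddCommGroup U] [Module ℂ U] (d : ℕ) :
    S n ⊗[ℂ] U →ₗ[ℂ] S n ⊗[ℂ] U :=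
  (MvPolynomial.homogeneousComponent d).rTensor U

@[simp]
lemma tensorComponent_tmul (d : ℕ) (f : S n) (u : U) :
    tensorComponent n U d (f ⊗ₜ u) = MvPolynomial.homogeneousComponent d f ⊗ₜ u := rfl

lemma tmul_mem_tensorPiece {d : ℕ} {f : S n} (hf : f.IsHomogeneous d) (u : U) :
    f ⊗ₜ[ℂ] u ∈ tensorPiece n U d :=
  ⟨(⟨f, hf⟩ : MvPolynomial.homogeneousSubmodule (Fin n) ℂ d) ⊗ₜ u, rfl⟩

lemma tensorPiece_induction {d : ℕ} {P : S n ⊗[ℂ] U → Prop} (h0 : P 0)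
    (htmul : ∀ (f : S n) (u : U), f.IsHomogeneous d → P (f ⊗ₜ u))
    (hadd : ∀ s t, P s → P t → P (s + t)) {t : S n ⊗[ℂ] U} (ht : t ∈ tensorPiece n U d) : P t := by
  obtain ⟨x, rfl⟩ := ht
  induction x using TensorProduct.induction_on with
  | zero => rwa [map_zero]
  | tmul f u => exact htmul f u f.2
  | add x y hx hy => rw [map_add]; exact hadd _ _ hx hy

lemma tensorComponent_mem (d : ℕ) (t : S n ⊗[ℂ] U) :
    tensorComponent n U d t ∈ tensorPiece n U d := by
  induction t using TensorProduct.induction_on with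
  | zero => rw [map_zero]; exact zero_mem _
  | tmul f u => exact tmul_mem_tensorPiece (MvPolynomial.homogeneousComponent_isHomogeneous d f) u
  | add x y hx hy => rw [map_add]; exact add_mem hx hy

lemma tensorComponent_of_mem {d : ℕ} {t : S n ⊗[ℂ] U} (ht : t ∈ tensorPiece n U d) (e : ℕ) :
    tensorComponent n U e t = if e = d then t else 0 := by
  refine tensorPiece_induction (P := fun t => tensorComponent n U e t = if e = d then t else 0)
    (by simp) (fun f u hf => ?_) (fun s t hs ht => ?_) ht
  · rw [tensorComponent_tmul, MvPolynomial.homogeneousComponent_of_mem hf]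
    split_ifs <;> simp
  · rw [map_add, hs, ht]; split_ifs <;> simp

lemma tensorComponent_smul_of_mem (f : S n) {e : ℕ} {t : S n ⊗[ℂ] U}
    (ht : t ∈ tensorPiece n U e) (D : ℕ) :
    tensorComponent n U D (f • t) =
      if e ≤ D then MvPolynomial.homogeneousComponent (D - e) f • t else 0 := by
  refine tensorPiece_induction (P := fun t => tensorComponent n U D (f • t) =
    if e ≤ D then MvPolynomial.homogeneousComponent (D - e) f • t else 0)
    (by simp) (fun p u hp => ?_) (fun s t hs ht => ?_) ht
  · rw [TensorProduct.smul_tmul', smul_eq_mul, tensorComponent_tmul,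
      homogeneousComponent_mul_of_isHomogeneous f hp]
    split_ifs <;> simp [TensorProduct.smul_tmul']
  · rw [smul_add, map_add, hs, ht]; split_ifs <;> simp

lemma smul_mem_tensorPiece {f : S n} {a e : ℕ} (hf : f.IsHomogeneous a) {t : S n ⊗[ℂ] U}
    (ht : t ∈ tensorPiece n U e) : f • t ∈ tensorPiece n U (a + e) := by
  refine tensorPiece_induction (P := fun t => f • t ∈ tensorPiece n U (a + e))
    (by rw [smul_zero]; exact zero_mem _) (fun p u hp => ?_) (fun s t hs ht => ?_) ht
  · rw [TensorProduct.smul_tmul', smul_eq_mul]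
    exact tmul_mem_tensorPiece (hf.mul hp) u
  · rw [smul_add]; exact add_mem hs ht

lemma exists_sum_tensorComponent (t : S n ⊗[ℂ] U) :
    ∃ s : Finset ℕ, t = ∑ d ∈ s, tensorComponent n U d t := by
  suffices h : ∃ N, ∀ M, N ≤ M → t = ∑ d ∈ Finset.range M, tensorComponent n U d t by
    obtain ⟨N, hN⟩ := h
    exact ⟨_, hN N le_rfl⟩
  induction t using TensorProduct.induction_on with
  | zero => exact ⟨0, by simp⟩
  | tmul f u =>
    refine ⟨f.totalDegree + 1, fun M hM => ?_⟩
    simp only [tensorComponent_tmul]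
    rw [← TensorProduct.sum_tmul]
    congr 1
    rw [← Finset.sum_subset (Finset.range_mono hM), MvPolynomial.sum_homogeneousComponent]
    intro d _ hd
    exact MvPolynomial.homogeneousComponent_eq_zero _ _ (by simpa using hd)
  | add x y hx hy =>
    obtain ⟨N, hN⟩ := hx
    obtain ⟨N', hN'⟩ := hy
    refine ⟨max N N', fun M hM => ?_⟩
    simp only [map_add, Finset.sum_add_distrib]
    rw [← hN M (le_trans (le_max_left _ _) hM), ← hN' M (le_trans (le_max_right _ _) hM)]

variable {W : Subgroup (GLV n)} {ρ : Representation ℂ W U}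

@[simp]
lemma tprod_tmul (w : W) (f : S n) (u : U) :
    ((polyRep W).tprod ρ) w (f ⊗ₜ u) = polyAct (w : GLV n) f ⊗ₜ ρ w u := rfl

lemma tensorComponent_tprod (w : W) (t : S n ⊗[ℂ] U) (d : ℕ) :
    tensorComponent n U d (((polyRep W).tprod ρ) w t) =
      ((polyRep W).tprod ρ) w (tensorComponent n U d t) := by
  induction t using TensorProduct.induction_on with
  | zero => simp
  | tmul f u =>
    rw [tprod_tmul, tensorComponent_tmul, tensorComponent_tmul, tprod_tmul,
      homogeneousComponent_polyAct]
  | add x y hx hy => simp only [map_add, hx, hy]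

lemma tensorComponent_mem_invTensor {t : S n ⊗[ℂ] U} (ht : t ∈ invTensor W ρ) (d : ℕ) :
    tensorComponent n U d t ∈ invTensor W ρ := by
  intro w
  rw [← tensorComponent_tprod, ht w]

variable (W ρ) in
/-- The sum over the group `W` of the translates of an element of `S(V*) ⊗ U`. -/
def orbitSum [Finite W] : S n ⊗[ℂ] U →ₗ[ℂ] S n ⊗[ℂ] U :=
  letI := Fintype.ofFinite W
  ∑ w : W, ((polyRep W).tprod ρ) w

lemma orbitSum_apply [Fintype W] (t : S n ⊗[ℂ] U) :
    orbitSum W ρ t = ∑ w : W, ((polyRep W).tprod ρ) w t := by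
  rw [orbitSum, LinearMap.sum_apply]
  exact Finset.sum_congr (by ext; simp) fun _ _ => rfl

lemma orbitSum_mem [Finite W] (t : S n ⊗[ℂ] U) : orbitSum W ρ t ∈ invTensor W ρ := by
  have := Fintype.ofFinite W
  intro w
  rw [orbitSum_apply, map_sum]
  refine Fintype.sum_bijective (fun v => w * v) (Group.mulLeft_bijective w) _ _ fun v => ?_
  rw [map_mul]; rfl

lemma orbitSum_of_mem [Finite W] {t : S n ⊗[ℂ] U} (ht : t ∈ invTensor W ρ) :
    orbitSum W ρ t = (Nat.card W : ℂ) • t := by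
  have := Fintype.ofFinite W
  rw [orbitSum_apply, Finset.sum_congr rfl fun w _ => ht w, Finset.sum_const, Finset.card_univ,
    Nat.card_eq_fintype_card, Nat.cast_smul_eq_nsmul]

lemma orbitSum_smul [Finite W] {f : S n} (hf : f ∈ invRing W) (t : S n ⊗[ℂ] U) :
    orbitSum W ρ (f • t) = f • orbitSum W ρ t := by
  have := Fintype.ofFinite W
  rw [orbitSum_apply, orbitSum_apply, Finset.smul_sum]
  refine Finset.sum_congr rfl fun w _ => ?_
  rw [polyRep_tprod_smul, hf w w.2]

end TensorGrading

/-! ### Divided differences and Chevalley's lemma -/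

lemma fixedSpace_inv {n : ℕ} (s : GLV n) : fixedSpace s⁻¹ = fixedSpace s := by
  have hinv : ∀ v, ((s⁻¹ : GLV n) : Module.End ℂ (V n)) ((s : Module.End ℂ (V n)) v) = v :=
    fun v => by rw [← Module.End.mul_apply, ← Units.val_mul, inv_mul_cancel]; rfl
  have hinv' : ∀ v, (s : Module.End ℂ (V n)) (((s⁻¹ : GLV n) : Module.End ℂ (V n)) v) = v :=
    fun v => by rw [← Module.End.mul_apply, ← Units.val_mul, mul_inv_cancel]; rfl
  ext v
  simp only [fixedSpace, LinearMap.mem_ker, LinearMap.sub_apply, Module.End.one_apply, sub_eq_zero]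
  constructor <;> intro h
  · conv_lhs => rw [← h, hinv']
  · conv_lhs => rw [← h, hinv]

/-- A reflection acts on polynomials as the identity modulo a nonzero linear form `α`, an equation of
its hyperplane. -/
lemma IsReflection.exists_linearForm {n : ℕ} {s : GLV n} (hs : IsReflection s) :
    ∃ α : S n, α ≠ 0 ∧ α.IsHomogeneous 1 ∧ ∀ p, α ∣ polyAct s p - p := by
  set T : Module.End ℂ (V n) := ((s⁻¹ : GLV n) : Module.End ℂ (V n)) - 1 with hT
  have hrank : Module.finrank ℂ (LinearMap.range T) = 1 := by
    have h1 := LinearMap.finrank_range_add_finrank_ker T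
    have h2 : Module.finrank ℂ (fixedSpace s) + 1 = n := hs
    rw [show LinearMap.ker T = fixedSpace s from fixedSpace_inv s, Module.finrank_fin_fun] at h1
    omega
  obtain ⟨⟨a, ha⟩, ha0, hspan⟩ := finrank_eq_one_iff'.1 hrank
  have hspan' : ∀ v, ∃ c : ℂ, c • a = T v := fun v => by
    obtain ⟨c, hc⟩ := hspan ⟨T v, v, rfl⟩
    exact ⟨c, congrArg Subtype.val hc⟩
  choose c hc using hspan'
  set α : S n := ∑ j, MvPolynomial.C (c (Pi.single j 1)) * MvPolynomial.X j with hα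
  have hX : ∀ i, polyAct s (MvPolynomial.X i) - MvPolynomial.X i = MvPolynomial.C (a i) * α := by
    intro i
    have h1 : (MvPolynomial.X i : S n) =
        ∑ j, MvPolynomial.C ((Pi.single j 1 : V n) i) * MvPolynomial.X j := by
      simp [Pi.single_apply]
    rw [show ∀ q : S n, q - MvPolynomial.X i = q - ∑ j, MvPolynomial.C ((Pi.single j 1 : V n) i) *
      MvPolynomial.X j from fun q => by rw [← h1], hα, Finset.mul_sum, polyAct,
      MvPolynomial.aeval_X, ← Finset.sum_sub_distrib]
    refine Finset.sum_congr rfl fun j _ => ?_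
    rw [← sub_mul, ← map_sub, ← mul_assoc, ← map_mul]
    congr 2
    have := congrFun (hc (Pi.single j 1)) i
    simp only [hT, Pi.smul_apply, smul_eq_mul, LinearMap.sub_apply, Module.End.one_apply,
      Pi.sub_apply] at this
    rw [← this, mul_comm]
  refine ⟨α, fun h0 => ha0 ?_, ?_, fun p => ?_⟩
  · obtain ⟨v, hv⟩ := ha
    have hcj : ∀ j, c (Pi.single j 1) = 0 := fun j => by
      have := congrArg (MvPolynomial.coeff (Finsupp.single j 1)) h0
      simpa [hα, MvPolynomial.coeff_sum, MvPolynomial.coeff_C_mul, MvPolynomial.coeff_X,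
        Finsupp.single_left_inj] using this
    have hT0 : T = 0 := by
      refine LinearMap.pi_ext' fun j => LinearMap.ext_ring ?_
      simpa [hcj j] using (hc (Pi.single j 1)).symm
    exact Subtype.ext (hv.symm.trans (by rw [hT0]; rfl))
  · exact MvPolynomial.IsHomogeneous.sum _ _ _ fun j _ => MvPolynomial.isHomogeneous_C_mul_X _ _
  · induction p using MvPolynomial.induction_on with
    | C r => rw [← MvPolynomial.algebraMap_eq, AlgHom.commutes, sub_self]; exact dvd_zero _
    | add p q hp hq => rw [map_add, add_sub_add_comm]; exact dvd_add hp hq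
    | mul_X p i hp =>
      have : polyAct s (p * MvPolynomial.X i) - p * MvPolynomial.X i =
          (polyAct s p - p) * polyAct s (MvPolynomial.X i) +
            p * (polyAct s (MvPolynomial.X i) - MvPolynomial.X i) := by rw [map_mul]; ring
      rw [this, hX]
      exact dvd_add (hp.mul_right _) ((Dvd.intro_left _ rfl).mul_left _)

lemma isHomogeneous_of_mul_left {n : ℕ} {α g : S n} {a d : ℕ} (hα : α ≠ 0)
    (ha : α.IsHomogeneous a) (hg : (α * g).IsHomogeneous (a + d)) : g.IsHomogeneous d := by
  have key : ∀ e, e ≠ d → MvPolynomial.homogeneousComponent e g = 0 := fun e he => by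
    have h1 := homogeneousComponent_mul_of_isHomogeneous g ha (e + a)
    rw [if_pos (Nat.le_add_left _ _), Nat.add_sub_cancel, mul_comm g,
      MvPolynomial.homogeneousComponent_of_mem hg, if_neg (by omega)] at h1
    exact (mul_eq_zero.1 h1.symm).resolve_right hα
  intro u hu
  by_contra h
  refine hu ?_
  have h2 := key u.degree (by rwa [Finsupp.degree_eq_weight_one])
  have h3 := congrArg (MvPolynomial.coeff u) h2
  rwa [MvPolynomial.coeff_homogeneousComponent, if_pos rfl, MvPolynomial.coeff_zero] at h3

/-- The divided difference operator `Δ = α⁻¹ (s - 1)` of a reflection `s`, where `α` is an equation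
of its hyperplane. -/
lemma IsReflection.exists_dividedDifference {n : ℕ} {s : GLV n} (hs : IsReflection s) :
    ∃ (α : S n) (Δ : S n → S n), (∀ p, polyAct s p - p = α * Δ p) ∧
      (∀ p q, Δ (p + q) = Δ p + Δ q) ∧ (∀ p q, Δ (p * q) = polyAct s p * Δ q + Δ p * q) ∧
      (∀ p, polyAct s p = p → Δ p = 0) ∧
      ∀ p d, p.IsHomogeneous (d + 1) → (Δ p).IsHomogeneous d := by
  obtain ⟨α, h0, h1, hdvd⟩ := hs.exists_linearForm
  choose Δ hΔ using hdvd
  refine ⟨α, Δ, hΔ, fun p q => mul_left_cancel₀ h0 ?_, fun p q => mul_left_cancel₀ h0 ?_,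
    fun p hp => mul_left_cancel₀ h0 ?_, fun p d hp => ?_⟩
  · rw [mul_add, ← hΔ, ← hΔ, ← hΔ, map_add]; ring
  · have : α * (polyAct s p * Δ q + Δ p * q) = polyAct s p * (α * Δ q) + (α * Δ p) * q := by ring
    rw [this, ← hΔ, ← hΔ, ← hΔ, map_mul]; ring
  · rw [← hΔ, hp, sub_self, mul_zero]
  · refine isHomogeneous_of_mul_left h0 h1 ?_
    rw [← hΔ, add_comm]
    exact (isHomogeneous_polyAct s hp).sub hp

/-- The ideal of `S(V*)` generated by the homogeneous invariants of positive degree. -/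
def positiveIdeal {n : ℕ} (W : Subgroup (GLV n)) : Ideal (S n) :=
  Ideal.span {f | f ∈ invRing W ∧ ∃ d, 0 < d ∧ f.IsHomogeneous d}

lemma polyAct_mem_positiveIdeal {n : ℕ} {W : Subgroup (GLV n)} {w : GLV n} (hw : w ∈ W) {f : S n}
    (hf : f ∈ positiveIdeal W) : polyAct w f ∈ positiveIdeal W := by
  have : positiveIdeal W ≤ (positiveIdeal W).comap (polyAct w) := by
    refine Ideal.span_le.2 fun g hg => ?_
    rw [SetLike.mem_coe, Ideal.mem_comap, hg.1 w hw]
    exact Ideal.subset_span hg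
  exact this hf

/-- A homogeneous polynomial of positive degree that every reflection fixes modulo the ideal
generated by the invariants of positive degree lies in that ideal, as it is congruent to its
average. -/
lemma mem_positiveIdeal_of_forall_isReflection {n : ℕ} {W : Subgroup (GLV n)}
    (hW : IsReflectionGroup W) {p : S n} {d : ℕ} (hd : 0 < d) (hp : p.IsHomogeneous d)
    (h : ∀ s ∈ W, IsReflection s → polyAct s p - p ∈ positiveIdeal W) : p ∈ positiveIdeal W := by
  have := hW.1
  have := Fintype.ofFinite W
  have hall : ∀ w ∈ W, polyAct w p - p ∈ positiveIdeal W := by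
    suffices hcl : ∀ w ∈ Subgroup.closure {g : GLV n | g ∈ W ∧ IsReflection g},
        w ∈ W ∧ polyAct w p - p ∈ positiveIdeal W from
      fun w hw => (hcl w (by rwa [hW.2])).2
    intro w hw
    induction hw using Subgroup.closure_induction with
    | mem x hx => exact ⟨hx.1, h x hx.1 hx.2⟩
    | one => exact ⟨one_mem _, by simp [polyAct_one]⟩
    | mul x y _ _ hx hy =>
      refine ⟨mul_mem hx.1 hy.1, ?_⟩
      have : polyAct (x * y) p - p = polyAct x (polyAct y p - p) + (polyAct x p - p) := by
        rw [polyAct_mul, AlgHom.comp_apply, map_sub]; ring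
      rw [this]
      exact add_mem (polyAct_mem_positiveIdeal hx.1 hy.2) hx.2
    | inv x _ hx =>
      refine ⟨inv_mem hx.1, ?_⟩
      have : polyAct x⁻¹ p - p = - polyAct x⁻¹ (polyAct x p - p) := by
        rw [map_sub, ← AlgHom.comp_apply, ← polyAct_mul, inv_mul_cancel, polyAct_one]; simp
      rw [this]
      exact neg_mem (polyAct_mem_positiveIdeal (inv_mem hx.1) hx.2)
  have hsum : ∑ w : W, polyAct (w : GLV n) p ∈ positiveIdeal W := by
    refine Ideal.subset_span ⟨fun w hw => ?_, d, hd,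
      MvPolynomial.IsHomogeneous.sum _ _ _ fun w _ => isHomogeneous_polyAct _ hp⟩
    rw [map_sum]
    refine Fintype.sum_bijective (fun v => (⟨w, hw⟩ : W) * v) (Group.mulLeft_bijective _) _ _
      fun v => ?_
    rw [Subgroup.coe_mul, polyAct_mul]; rfl
  have h2 : (Fintype.card W : S n) * p ∈ positiveIdeal W := by
    have : (Fintype.card W : S n) * p =
        ∑ w : W, polyAct (w : GLV n) p - ∑ w : W, (polyAct (w : GLV n) p - p) := by
      rw [Finset.sum_sub_distrib, Finset.sum_const, Finset.card_univ, nsmul_eq_mul]; ring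
    rw [this]
    exact sub_mem hsum (sum_mem fun w _ => hall w w.2)
  have hne : (Fintype.card W : ℂ) ≠ 0 := Nat.cast_ne_zero.2 Fintype.card_ne_zero
  have h3 := Ideal.mul_mem_left _ (MvPolynomial.C (Fintype.card W : ℂ)⁻¹) h2
  rwa [← mul_assoc, ← map_natCast (MvPolynomial.C : ℂ →+* S n), ← map_mul, inv_mul_cancel₀ hne,
    map_one, one_mul] at h3

/-- Chevalley's lemma on syzygies, in a form without a choice of minimal relations: if invariants
`h i` and homogeneous polynomials `p i` of the same degree satisfy `∑ h i * p i ∈ J`, where the ideal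
`J` is generated by invariants, then `∑ φ (h i) p i` lies in the ideal generated by the invariants of
positive degree, for each linear functional `φ` that vanishes on `J`. -/
lemma sum_smul_mem_positiveIdeal {n : ℕ} {W : Subgroup (GLV n)} (hW : IsReflectionGroup W)
    {A : Set (S n)} (hA : ∀ f ∈ A, f ∈ invRing W) (φ : S n →ₗ[ℂ] ℂ)
    (hφ : ∀ f ∈ Ideal.span A, φ f = 0) {ι : Type*} (s : Finset ι) (h : ι → S n)
    (hh : ∀ i ∈ s, h i ∈ invRing W) (d : ℕ) (p : ι → S n)
    (hp : ∀ i ∈ s, (p i).IsHomogeneous d) (hsum : ∑ i ∈ s, h i * p i ∈ Ideal.span A) :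
    ∑ i ∈ s, φ (h i) • p i ∈ positiveIdeal W := by
  induction d generalizing p with
  | zero =>
    -- The `p i` are constants, so that the sum is `φ` of an element of `J`, which is zero.
    have hC : ∀ i ∈ s, p i = MvPolynomial.C (MvPolynomial.coeff 0 (p i)) := fun i hi =>
      MvPolynomial.totalDegree_eq_zero_iff_eq_C.1
        ((MvPolynomial.totalDegree_zero_iff_isHomogeneous _).2 (hp i hi))
    have h1 := hφ _ hsum
    have h2 : ∑ i ∈ s, φ (h i) • p i = MvPolynomial.C (φ (∑ i ∈ s, h i * p i)) := by
      rw [map_sum, map_sum]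
      refine Finset.sum_congr rfl fun i hi => ?_
      rw [hC i hi, mul_comm (h i), ← MvPolynomial.smul_eq_C_mul, map_smul,
        MvPolynomial.smul_eq_C_mul, smul_eq_mul, map_mul, mul_comm]
    rw [h2, h1, map_zero]
    exact zero_mem _
  | succ d ih =>
    refine mem_positiveIdeal_of_forall_isReflection hW (Nat.succ_pos d)
      (MvPolynomial.IsHomogeneous.sum _ _ _ fun i hi => ?_) fun r hr hrefl => ?_
    · rw [MvPolynomial.smul_eq_C_mul]; exact (hp i hi).C_mul _
    obtain ⟨α, Δ, hΔ, hadd, hmul, hinv, hdeg⟩ := hrefl.exists_dividedDifference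
    -- `Δ` maps `J` to itself, so that the `Δ (p i)` satisfy the hypothesis in degree `d`.
    have hJ : ∀ x ∈ Ideal.span A, Δ x ∈ Ideal.span A := by
      intro x hx
      induction hx using Submodule.span_induction with
      | mem a ha => rw [hinv a (hA a ha r hr)]; exact zero_mem _
      | zero => rw [hinv 0 (map_zero _)]; exact zero_mem _
      | add x y _ _ hx hy => rw [hadd]; exact add_mem hx hy
      | smul q x hx' hx =>
        rw [smul_eq_mul, hmul]
        exact add_mem (Ideal.mul_mem_left _ _ hx) (Ideal.mul_mem_left _ _ hx')
    have hΔsum : ∀ g : ι → S n, Δ (∑ i ∈ s, g i) = ∑ i ∈ s, Δ (g i) := fun g =>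
      map_sum (AddMonoidHom.mk' Δ hadd) g s
    have h1 := ih (fun i => Δ (p i)) (fun i hi => hdeg _ _ (hp i hi)) (by
      have := hJ _ hsum
      rw [hΔsum] at this
      refine (congrArg (· ∈ Ideal.span A) (Finset.sum_congr rfl fun i hi => ?_)).mp this
      rw [hmul, hinv _ (hh i hi r hr), hh i hi r hr, zero_mul, add_zero])
    have h2 : polyAct r (∑ i ∈ s, φ (h i) • p i) - ∑ i ∈ s, φ (h i) • p i =
        α * ∑ i ∈ s, φ (h i) • Δ (p i) := by
      rw [map_sum, ← Finset.sum_sub_distrib, Finset.mul_sum]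
      refine Finset.sum_congr rfl fun i _ => ?_
      rw [map_smul, ← smul_sub, hΔ, mul_smul_comm]
    rw [h2]
    exact Ideal.mul_mem_left _ _ h1

/-! ### Freeness of `(S(V*) ⊗ U)^W` over `S(V*)^W` -/

section Freeness

variable {U : Type} [AddCommGroup U] [Module ℂ U] {n : ℕ}

/-- The subspace `S(V*)^W_+ · (S(V*) ⊗ U)^W` of `(S(V*) ⊗ U)^W`, given by homogeneous generators. -/
def positivePart (W : Subgroup (GLV n)) (ρ : Representation ℂ W U) : Submodule ℂ (S n ⊗[ℂ] U) :=
  Submodule.span ℂ {t | ∃ (g : S n) (m : S n ⊗[ℂ] U) (a e : ℕ), g ∈ invRing W ∧ 0 < a ∧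
    g.IsHomogeneous a ∧ m ∈ invTensor W ρ ∧ m ∈ tensorPiece n U e ∧ t = g • m}

variable {W : Subgroup (GLV n)} {ρ : Representation ℂ W U}

lemma orbitSum_smul_mem_positivePart [Finite W] {q : S n} (hq : q ∈ positiveIdeal W) :
    ∀ t, orbitSum W ρ (q • t) ∈ positivePart W ρ := by
  induction hq using Submodule.span_induction with
  | mem g hg =>
    intro t
    obtain ⟨hgW, a, ha, hga⟩ := hg
    rw [orbitSum_smul hgW]
    obtain ⟨s, hs⟩ := exists_sum_tensorComponent (orbitSum W ρ t)
    rw [hs, Finset.smul_sum]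
    exact sum_mem fun d _ => Submodule.subset_span ⟨g, _, a, d, hgW, ha, hga,
      tensorComponent_mem_invTensor (orbitSum_mem t) d, tensorComponent_mem d _, rfl⟩
  | zero => intro t; rw [zero_smul, map_zero]; exact zero_mem _
  | add x y _ _ hx hy => intro t; rw [add_smul, map_add]; exact add_mem (hx t) (hy t)
  | smul r x _ hx =>
    intro t
    rw [smul_eq_mul, mul_comm, mul_smul]
    exact hx _

/-- By averaging, an element of `(S(V*) ⊗ U)^W` whose coordinates lie in the ideal of `S(V*)`
generated by `S(V*)^W_+` belongs to `S(V*)^W_+ · (S(V*) ⊗ U)^W`. -/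
lemma mem_positivePart_of_repr_mem [Finite W] {ι : Type*} (bU : Module.Basis ι ℂ U)
    {t : S n ⊗[ℂ] U} (ht : t ∈ invTensor W ρ)
    (h : ∀ j, (Algebra.TensorProduct.basis (S n) bU).repr t j ∈ positiveIdeal W) :
    t ∈ positivePart W ρ := by
  have h1 : orbitSum W ρ t ∈ positivePart W ρ := by
    rw [← (Algebra.TensorProduct.basis (S n) bU).linearCombination_repr t,
      Finsupp.linearCombination_apply, Finsupp.sum, map_sum]
    exact sum_mem fun j _ => orbitSum_smul_mem_positivePart (h j) _
  rw [orbitSum_of_mem ht] at h1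
  have hne : (Nat.card W : ℂ) ≠ 0 := Nat.cast_ne_zero.2 Nat.card_pos.ne'
  exact ((positivePart W ρ).smul_mem_iff hne).1 h1

lemma isHomogeneous_basis_repr {ι : Type*} (bU : Module.Basis ι ℂ U) {t : S n ⊗[ℂ] U} {d : ℕ}
    (ht : t ∈ tensorPiece n U d) (j : ι) :
    ((Algebra.TensorProduct.basis (S n) bU).repr t j).IsHomogeneous d := by
  refine tensorPiece_induction
    (P := fun t => ((Algebra.TensorProduct.basis (S n) bU).repr t j).IsHomogeneous d) ?_ ?_ ?_ ht
  · rw [map_zero]; exact MvPolynomial.isHomogeneous_zero _ _ _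
  · intro f u hf
    rw [Algebra.TensorProduct.basis_repr_tmul, Finsupp.smul_apply, smul_eq_mul,
      Finsupp.mapRange_apply, mul_comm, MvPolynomial.algebraMap_eq]
    exact hf.C_mul _
  · intro s t hs ht
    rw [map_add]; exact hs.add ht

/-- Graded Nakayama lemma: homogeneous elements that span `(S(V*) ⊗ U)^W` modulo
`S(V*)^W_+ · (S(V*) ⊗ U)^W` generate it over `S(V*)^W`. -/
lemma span_eq_invTensor_of_span_quotient {κ : Type*} (b : κ → S n ⊗[ℂ] U) (d : κ → ℕ)
    (hb : ∀ k, b k ∈ invTensor W ρ) (hd : ∀ k, b k ∈ tensorPiece n U (d k))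
    (hspan : ∀ t ∈ invTensor W ρ, ∀ e, t ∈ tensorPiece n U e → (positivePart W ρ).mkQ t ∈
      Submodule.span ℂ (Set.range fun k => (positivePart W ρ).mkQ (b k))) :
    Submodule.span (invRing W) (Set.range b) = invTensor W ρ := by
  set N := Submodule.span (invRing W) (Set.range b) with hN
  refine le_antisymm (Submodule.span_le.2 (by rintro _ ⟨k, rfl⟩; exact hb k)) fun t ht => ?_
  suffices key : ∀ D, ∀ x ∈ invTensor W ρ, x ∈ tensorPiece n U D → x ∈ N by
    obtain ⟨s, hs⟩ := exists_sum_tensorComponent t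
    rw [hs]
    exact sum_mem fun e _ => key e _ (tensorComponent_mem_invTensor ht e) (tensorComponent_mem e t)
  intro D
  induction D using Nat.strong_induction_on with
  | _ D ih =>
    intro x hx hxD
    obtain ⟨c, hc⟩ := (Finsupp.mem_span_range_iff_exists_finsupp).1 (hspan x hx D hxD)
    set z := c.sum fun k a => a • b k with hz
    have hxz : x - z ∈ positivePart W ρ := by
      rw [← Submodule.Quotient.mk_eq_zero, Submodule.Quotient.mk_sub, sub_eq_zero]
      refine hc.symm.trans ?_
      rw [hz, ← Submodule.mkQ_apply, Finsupp.sum, Finsupp.sum, map_sum]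
      exact Finset.sum_congr rfl fun k _ => (map_smul _ _ _).symm
    have hle : positivePart W ρ ≤ (N.restrictScalars ℂ).comap (tensorComponent n U D) := by
      refine Submodule.span_le.2 ?_
      rintro _ ⟨g, m, a, e, hg, ha, hga, hm, hme, rfl⟩
      rw [SetLike.mem_coe, Submodule.mem_comap, Submodule.restrictScalars_mem,
        tensorComponent_of_mem (smul_mem_tensorPiece hga hme)]
      split_ifs with h
      · exact N.smul_mem (⟨g, hg⟩ : invRing W) (ih e (by omega) m hm hme)
      · exact zero_mem _
    have h1 : tensorComponent n U D (x - z) ∈ N := hle hxz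
    have h2 : tensorComponent n U D z ∈ N := by
      rw [hz, Finsupp.sum, map_sum]
      refine sum_mem fun k _ => ?_
      rw [map_smul, tensorComponent_of_mem (hd k)]
      refine (N.restrictScalars ℂ).smul_mem _ ?_
      split_ifs
      · exact Submodule.subset_span ⟨k, rfl⟩
      · exact zero_mem _
    have h3 := add_mem h1 h2
    rwa [← map_add, sub_add_cancel, tensorComponent_of_mem hxD, if_pos rfl] at h3

lemma coeff_eq_zero_of_mem_span {δ : ℕ} {A : Set (S n)}
    (hA : ∀ f ∈ A, ∃ e, δ < e ∧ f.IsHomogeneous e) {f : S n} (hf : f ∈ Ideal.span A) :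
    ∀ u : Fin n →₀ ℕ, u.degree ≤ δ → MvPolynomial.coeff u f = 0 := by
  induction hf using Submodule.span_induction with
  | mem a ha =>
    intro u hu
    obtain ⟨e, he, hae⟩ := hA a ha
    exact hae.coeff_eq_zero (by omega)
  | zero => intro u _; exact MvPolynomial.coeff_zero _
  | add x y _ _ hx hy => intro u hu; rw [MvPolynomial.coeff_add, hx u hu, hy u hu, add_zero]
  | smul r x _ hx =>
    intro u hu
    rw [smul_eq_mul, MvPolynomial.coeff_mul]
    refine Finset.sum_eq_zero fun v hv => ?_
    rw [hx v.2, mul_zero]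
    have := congrArg Finsupp.degree (Finset.HasAntidiagonal.mem_antidiagonal.1 hv)
    rw [map_add] at this
    omega

/-- Homogeneous elements of `(S(V*) ⊗ U)^W` that are linearly independent over `ℂ` modulo
`S(V*)^W_+ · (S(V*) ⊗ U)^W` are linearly independent over `S(V*)^W`. -/
lemma linearIndependent_of_linearIndependent_quotient (hW : IsReflectionGroup W)
    {κ : Type*} (b : κ → S n ⊗[ℂ] U) (d : κ → ℕ) (hb : ∀ k, b k ∈ invTensor W ρ)
    (hd : ∀ k, b k ∈ tensorPiece n U (d k))
    (hli : LinearIndependent ℂ fun k => (positivePart W ρ).mkQ (b k)) :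
    LinearIndependent (invRing W) b := by
  have := hW.1
  set bU := Module.Basis.ofVectorSpace ℂ U
  set B := Algebra.TensorProduct.basis (S n) bU with hB
  rw [linearIndependent_iff']
  intro s g hg
  -- The component of the relation in total degree `D` is treated by induction on the degree `δ`
  -- of the coefficients, that is, downwards along the degrees of the `b k`.
  suffices key : ∀ D δ, ∀ i ∈ s, d i + δ = D →
      MvPolynomial.homogeneousComponent δ (g i : S n) = 0 by
    intro i hi
    ext1
    rw [← MvPolynomial.sum_homogeneousComponent (g i : S n)]
    exact Finset.sum_eq_zero fun δ _ => key _ δ i hi rfl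
  intro D δ
  induction δ using Nat.strong_induction_on with
  | _ δ ih =>
    intro i₀ hi₀ hD
    have hcoord : ∀ j, ∑ i ∈ s with d i ≤ D,
        MvPolynomial.homogeneousComponent (D - d i) (g i : S n) * B.repr (b i) j = 0 := by
      intro j
      have h1 := congrArg (tensorComponent n U D) hg
      rw [map_sum, map_zero] at h1
      have h2 : ∀ i ∈ s, tensorComponent n U D (g i • b i) = if d i ≤ D then
          MvPolynomial.homogeneousComponent (D - d i) (g i : S n) • b i else 0 := fun i _ =>
        tensorComponent_smul_of_mem (g i : S n) (hd i) D
      rw [Finset.sum_congr rfl h2, ← Finset.sum_filter] at h1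
      have h3 := congrArg (fun t => B.repr t j) h1
      simpa [Finsupp.finsetSum_apply] using h3
    -- Coefficients of degree below `δ` vanish by induction and those of degree above `δ` lie in the
    -- ideal `J` generated by `A`; what is left are the terms with `d i = d i₀`.
    set A : Set (S n) := {f | f ∈ invRing W ∧ ∃ e, δ < e ∧ f.IsHomogeneous e} with hA
    have hmem : ∀ j, ∑ i ∈ s with d i = d i₀,
        MvPolynomial.homogeneousComponent δ (g i : S n) * B.repr (b i) j ∈ Ideal.span A := by
      intro j
      have h1 := hcoord j
      rw [← Finset.sum_filter_add_sum_filter_not _ (fun i => d i = d i₀)] at h1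
      have h2 : ∑ i ∈ s with d i = d i₀, MvPolynomial.homogeneousComponent δ (g i : S n) *
          B.repr (b i) j = ∑ i ∈ (s.filter fun i => d i ≤ D) with d i = d i₀,
          MvPolynomial.homogeneousComponent (D - d i) (g i : S n) * B.repr (b i) j := by
        rw [Finset.filter_filter]
        refine Finset.sum_congr (Finset.filter_congr fun i _ => ?_) fun i hi => ?_
        · constructor
          · intro h; exact ⟨by omega, h⟩
          · exact fun h => h.2
        · have := (Finset.mem_filter.1 hi).2
          rw [show D - d i = δ by omega]
      rw [h2, eq_neg_of_add_eq_zero_left h1]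
      refine neg_mem (sum_mem fun i hi => ?_)
      simp only [Finset.mem_filter] at hi
      obtain ⟨⟨his, hiD⟩, hne⟩ := hi
      rcases lt_or_gt_of_ne hne with hlt | hgt
      · exact Ideal.mul_mem_right _ _ (Ideal.subset_span
          ⟨homogeneousComponent_mem_invRing (g i).2 _, D - d i, by omega,
            MvPolynomial.homogeneousComponent_isHomogeneous _ _⟩)
      · rw [ih (D - d i) (by omega) i his (by omega), zero_mul]
        exact zero_mem _
    ext u
    rw [MvPolynomial.coeff_zero]
    by_cases hu : u.degree = δ
    swap
    · rw [MvPolynomial.coeff_homogeneousComponent, if_neg hu]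
    -- Taking the coefficient of a monomial of degree `δ` is a functional that vanishes on `J`.
    have hpos : ∀ j, ∑ i ∈ s with d i = d i₀,
        MvPolynomial.coeff u (MvPolynomial.homogeneousComponent δ (g i : S n)) •
          B.repr (b i) j ∈ positiveIdeal W := fun j =>
      sum_smul_mem_positiveIdeal hW (A := A) (fun f hf => hf.1) (MvPolynomial.lcoeff ℂ u)
        (fun f hf => coeff_eq_zero_of_mem_span (fun f hf => hf.2) hf u hu.le) _ _
        (fun i _ => homogeneousComponent_mem_invRing (g i).2 _) (d i₀) _
        (fun i hi => (Finset.mem_filter.1 hi).2 ▸ isHomogeneous_basis_repr bU (hd i) j) (hmem j)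
    have hzero := mem_positivePart_of_repr_mem (W := W) (ρ := ρ) bU
      (t := ∑ i ∈ s with d i = d i₀,
        MvPolynomial.coeff u (MvPolynomial.homogeneousComponent δ (g i : S n)) • b i)
      (sum_mem fun i _ => ((invTensor W ρ).restrictScalars ℂ).smul_mem _ (hb i)) fun j => by
        have := hpos j
        simp only [map_sum, Finsupp.finsetSum_apply]
        refine (congrArg (· ∈ positiveIdeal W) (Finset.sum_congr rfl fun i _ => ?_)).mp this
        rw [← algebraMap_smul (S n) _ (b i), map_smul, Finsupp.smul_apply, algebraMap_smul]
    rw [← Submodule.Quotient.mk_eq_zero, ← Submodule.mkQ_apply, map_sum] at hzero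
    simp only [map_smul] at hzero
    exact (linearIndependent_iff'.1 hli) _ _ hzero i₀ (by simp [hi₀])

/-- `(S(V*) ⊗ U)^W` has a homogeneous basis over `S(V*)^W`. -/
lemma exists_homogeneous_linearIndependent_span (hW : IsReflectionGroup W)
    (ρ : Representation ℂ W U) :
    ∃ (κ : Type) (b : κ → S n ⊗[ℂ] U) (d : κ → ℕ), (∀ k, b k ∈ tensorPiece n U (d k)) ∧
      LinearIndependent (invRing W) b ∧
      Submodule.span (invRing W) (Set.range b) = invTensor W ρ := by
  let ι := {x : (S n ⊗[ℂ] U) × ℕ // x.1 ∈ invTensor W ρ ∧ x.1 ∈ tensorPiece n U x.2}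
  obtain ⟨κ, a, -, hspan, hli⟩ := exists_linearIndependent' ℂ
    fun x : ι => (positivePart W ρ).mkQ x.1.1
  refine ⟨κ, fun k => (a k).1.1, fun k => (a k).1.2, fun k => (a k).2.2,
    linearIndependent_of_linearIndependent_quotient hW _ _ (fun k => (a k).2.1)
      (fun k => (a k).2.2) hli,
    span_eq_invTensor_of_span_quotient _ _ (fun k => (a k).2.1) (fun k => (a k).2.2) ?_⟩
  intro t ht e hte
  refine (hspan.ge : _) (Submodule.subset_span ⟨⟨(t, e), ht, hte⟩, rfl⟩)

end Freeness

/-- `S(V*)` is a finite module over `S(V*)^W`. -/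
lemma finite_invRing {n : ℕ} (W : Subgroup (GLV n)) [Finite W] : Module.Finite (invRing W) (S n) := by
  let _ : MulSemiringAction W (S n) :=
    { smul := fun w f => polyAct (w : GLV n) f
      one_smul := fun f => by change polyAct ((1 : W) : GLV n) f = f; simp [polyAct_one]
      mul_smul := fun v w f => by
        change polyAct ((v * w : W) : GLV n) f = polyAct (v : GLV n) (polyAct (w : GLV n) f)
        rw [Subgroup.coe_mul, polyAct_mul]; rfl
      smul_zero := fun w => map_zero (polyAct (w : GLV n))
      smul_add := fun w => map_add (polyAct (w : GLV n))
      smul_one := fun w => map_one (polyAct (w : GLV n))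
      smul_mul := fun w => map_mul (polyAct (w : GLV n)) }
  have : Algebra.IsInvariant (invRing W) (S n) W :=
    ⟨fun f hf => ⟨⟨f, fun w hw => hf ⟨w, hw⟩⟩, rfl⟩⟩
  have := Algebra.IsInvariant.isIntegral (invRing W) (S n) W
  have : Algebra.FiniteType (invRing W) (S n) :=
    Algebra.FiniteType.of_restrictScalars_finiteType ℂ (invRing W) (S n)
  exact Algebra.IsIntegral.finite

lemma finite_index_of_linearIndependent {n : ℕ} (W : Subgroup (GLV n)) [Finite W] {U : Type}
    [AddCommGroup U] [Module ℂ U] [Module.Finite ℂ U] {κ : Type} {b : κ → S n ⊗[ℂ] U}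
    (hb : LinearIndependent (invRing W) b) : Finite κ := by
  have := finite_invRing W
  have : Module.Finite (invRing W) (S n ⊗[ℂ] U) := Module.Finite.trans (S n) _
  have := hb.lt_aleph0_of_finite
  exact Cardinal.lt_aleph0_iff_finite.1 this

/-- A linearly independent homogeneous generating family, indexed by `Fin m`, is a homogeneous
basis. -/
lemma isHomogeneousBasis_of_linearIndependent {n m : ℕ} {W : Subgroup (GLV n)} {U : Type}
    [AddCommGroup U] [Module ℂ U] {ρ : Representation ℂ W U} {b : Fin m → S n ⊗[ℂ] U} {d : Fin m → ℕ}
    (hd : ∀ k, b k ∈ tensorPiece n U (d k)) (hli : LinearIndependent (invRing W) b)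
    (hspan : Submodule.span (invRing W) (Set.range b) = invTensor W ρ) :
    IsHomogeneousBasis W ρ b d := by
  have hmem : ∀ i, b i ∈ invTensor W ρ := fun i => hspan ▸ Submodule.subset_span ⟨i, rfl⟩
  let v : Fin m → invTensor W ρ := fun i => ⟨b i, hmem i⟩
  have hv : LinearIndependent (invRing W) v :=
    LinearIndependent.of_comp (invTensor W ρ).subtype hli
  have hsp : ⊤ ≤ Submodule.span (invRing W) (Set.range v) := by
    rintro ⟨t, ht⟩ -
    rw [← hspan] at ht
    obtain ⟨c, hc⟩ := (Submodule.mem_span_range_iff_exists_fun _).1 ht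
    exact (Submodule.mem_span_range_iff_exists_fun _).2 ⟨c, Subtype.ext (by simpa [v] using hc)⟩
  exact ⟨⟨Module.Basis.mk hv hsp, fun i => by rw [Module.Basis.mk_apply]⟩, hd⟩

/-- `(S(V*) ⊗ U)^W` has a finite homogeneous basis over `S(V*)^W`, with weakly increasing degrees. -/
lemma exists_isUExponents {n : ℕ} {W : Subgroup (GLV n)} (hW : IsReflectionGroup W) {U : Type}
    [AddCommGroup U] [Module ℂ U] [Module.Finite ℂ U] (ρ : Representation ℂ W U) :
    ∃ (m : ℕ) (d : Fin m → ℕ), IsUExponents W ρ d := by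
  have := hW.1
  obtain ⟨κ, b, d, hd, hli, hspan⟩ := exists_homogeneous_linearIndependent_span hW ρ
  have := finite_index_of_linearIndependent W hli
  obtain ⟨m, ⟨e⟩⟩ := Finite.exists_equiv_fin κ
  set σ := (Tuple.sort (d ∘ e.symm)).trans e.symm with hσ
  refine ⟨m, d ∘ σ, Tuple.monotone_sort (d ∘ e.symm), b ∘ σ,
    isHomogeneousBasis_of_linearIndependent (fun k => hd (σ k)) (hli.comp _ σ.injective) ?_⟩
  rw [Set.range_comp, σ.surjective.range_eq, Set.image_univ, hspan]

/-! ### Diagonalization and traces -/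

lemma trace_eq_sum_of_apply_basis {ι M : Type*} [Fintype ι] [AddCommGroup M] [Module ℂ M]
    (b : Module.Basis ι ℂ M) (T : M →ₗ[ℂ] M) (c : ι → ℂ) (h : ∀ i, T (b i) = c i • b i) :
    LinearMap.trace ℂ M T = ∑ i, c i := by
  classical
  rw [LinearMap.trace_eq_matrix_trace ℂ b, Matrix.trace]
  refine Finset.sum_congr rfl fun i _ => ?_
  rw [Matrix.diag_apply, LinearMap.toMatrix_apply, h, map_smul, Finsupp.smul_apply,
    Module.Basis.repr_self, Finsupp.single_eq_same, smul_eq_mul, mul_one]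

/-- An endomorphism of finite order of a finite-dimensional complex vector space has an eigenbasis. -/
lemma exists_eigenbasis_of_pow_eq_one {M : Type*} [AddCommGroup M] [Module ℂ M]
    [FiniteDimensional ℂ M] (T : Module.End ℂ M) {m : ℕ} (hm : 0 < m) (hT : T ^ m = 1) :
    ∃ (b : Module.Basis (Fin (Module.finrank ℂ M)) ℂ M) (c : Fin (Module.finrank ℂ M) → ℂ),
      ∀ i, T (b i) = c i • b i := by
  have hss : T.IsSemisimple := by
    refine Module.End.isSemisimple_of_squarefree_aeval_eq_zero (p := Polynomial.X ^ m - 1)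
      ((Polynomial.X_pow_sub_one_separable_iff (F := ℂ)).2
        (Nat.cast_ne_zero.2 hm.ne')).squarefree ?_
    rw [map_sub, map_pow, Polynomial.aeval_X, map_one, hT, sub_self]
  have htop : Submodule.span ℂ {v : M | ∃ c : ℂ, T v = c • v} = ⊤ := by
    rw [eq_top_iff, ← hss.iSup_eigenspace_eq_top]
    exact iSup_le fun c v hv => Submodule.subset_span ⟨c, Module.End.mem_eigenspace_iff.1 hv⟩
  obtain ⟨B, hB, hspan, hli⟩ := exists_linearIndependent ℂ {v : M | ∃ c : ℂ, T v = c • v}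
  have b₀ : ∃ b : Module.Basis B ℂ M, ∀ i, b i = i :=
    ⟨Module.Basis.mk hli (by rw [Subtype.range_coe, hspan, htop]), fun i => by simp⟩
  obtain ⟨b₀, hb₀⟩ := b₀
  have := Module.Finite.finite_basis b₀
  have := Fintype.ofFinite B
  let e := Fintype.equivFinOfCardEq (Module.finrank_eq_card_basis b₀).symm
  have hc : ∀ i, ∃ c : ℂ, T (b₀.reindex e i) = c • b₀.reindex e i := fun i => by
    rw [Module.Basis.reindex_apply, hb₀]; exact hB (e.symm i).2
  choose c hc using hc
  exact ⟨_, c, hc⟩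

lemma exists_eigenbasis {n : ℕ} {W : Subgroup (GLV n)} [Finite W] {w : GLV n} (hw : w ∈ W) :
    ∃ (b : Module.Basis (Fin n) ℂ (V n)) (c : Fin n → ℂ),
      ∀ i, (w : Module.End ℂ (V n)) (b i) = c i • b i := by
  have hpow : (w : Module.End ℂ (V n)) ^ Nat.card W = 1 := by
    have h := congrArg Subtype.val (pow_card_eq_one' (x := (⟨w, hw⟩ : W)))
    rw [Subgroup.coe_pow, Subgroup.coe_one] at h
    rw [← Units.val_pow_eq_pow_val, h, Units.val_one]
  obtain ⟨b, c, h⟩ := exists_eigenbasis_of_pow_eq_one _ Nat.card_pos hpow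
  have e : Module.finrank ℂ (V n) = n := Module.finrank_fin_fun ℂ
  exact ⟨b.reindex (finCongr e), fun i => c ((finCongr e).symm i), fun i => by
    rw [Module.Basis.reindex_apply, h]⟩

/-! ### Molien's formula -/

/-- The action of `g` on the homogeneous polynomials of degree `d`. -/
def polyPiece {n : ℕ} (g : GLV n) (d : ℕ) :
    Module.End ℂ (MvPolynomial.homogeneousSubmodule (Fin n) ℂ d) :=
  (polyAct g).toLinearMap.restrict fun _ hf => isHomogeneous_polyAct g hf

lemma polyPiece_mul {n : ℕ} (g h : GLV n) (d : ℕ) :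
    polyPiece (g * h) d = polyPiece g d * polyPiece h d := by
  ext1 f
  refine Subtype.ext ?_
  change polyAct (g * h) (f : S n) = polyAct g (polyAct h (f : S n))
  rw [polyAct_mul]; rfl

lemma polyPiece_one {n : ℕ} (d : ℕ) : polyPiece (1 : GLV n) d = 1 := by
  ext1 f
  exact Subtype.ext (by simp [polyPiece, polyAct_one])

/-- The representation of `W` on the homogeneous polynomials of degree `d`. -/
def pieceRep {n : ℕ} (W : Subgroup (GLV n)) (d : ℕ) :
    Representation ℂ W (MvPolynomial.homogeneousSubmodule (Fin n) ℂ d) where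
  toFun w := polyPiece (w : GLV n) d
  map_one' := polyPiece_one d
  map_mul' v w := polyPiece_mul (v : GLV n) w d

/-- The monomials of degree `d` form a basis of the homogeneous polynomials of degree `d`. -/
lemma exists_monomial_basis (n d : ℕ) :
    ∃ b : Module.Basis ((Finset.univ : Finset (Fin n)).finsuppAntidiag d) ℂ
      (MvPolynomial.homogeneousSubmodule (Fin n) ℂ d),
      ∀ u, (b u : S n) = MvPolynomial.monomial (u : Fin n →₀ ℕ) 1 := by
  have hdeg : ∀ u : Fin n →₀ ℕ, u ∈ (Finset.univ : Finset (Fin n)).finsuppAntidiag d ↔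
      u.degree = d := fun u => by
    rw [Finset.mem_finsuppAntidiag, Finsupp.degree_eq_sum]
    simp
  let v : (Finset.univ : Finset (Fin n)).finsuppAntidiag d →
      MvPolynomial.homogeneousSubmodule (Fin n) ℂ d := fun u =>
    ⟨MvPolynomial.monomial (u : Fin n →₀ ℕ) 1,
      MvPolynomial.isHomogeneous_monomial 1 ((hdeg _).1 u.2)⟩
  have hv : LinearIndependent ℂ v := by
    refine LinearIndependent.of_comp (MvPolynomial.homogeneousSubmodule (Fin n) ℂ d).subtype ?_
    have := (MvPolynomial.basisMonomials (Fin n) ℂ).linearIndependent.comp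
      (fun u : (Finset.univ : Finset (Fin n)).finsuppAntidiag d => (u : Fin n →₀ ℕ))
      Subtype.val_injective
    rw [MvPolynomial.coe_basisMonomials] at this
    exact this
  have hsp : ⊤ ≤ Submodule.span ℂ (Set.range v) := by
    rintro ⟨f, hf⟩ -
    have hsum : (⟨f, hf⟩ : MvPolynomial.homogeneousSubmodule (Fin n) ℂ d) =
        ∑ u ∈ f.support.attach, MvPolynomial.coeff (u : Fin n →₀ ℕ) f •
          v ⟨u, (hdeg _).2 (by
            rw [Finsupp.degree_eq_weight_one]; exact hf (MvPolynomial.mem_support_iff.1 u.2))⟩ := by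
      ext1
      rw [AddSubmonoidClass.coe_finsetSum]
      simp only [v, Submodule.coe_smul, MvPolynomial.smul_monomial, smul_eq_mul, mul_one]
      rw [Finset.sum_attach f.support fun u => MvPolynomial.monomial u (MvPolynomial.coeff u f)]
      exact f.as_sum
    rw [hsum]
    exact sum_mem fun u _ => Submodule.smul_mem _ _ (Submodule.subset_span ⟨_, rfl⟩)
  exact ⟨Module.Basis.mk hv hsp, fun u => by rw [Module.Basis.mk_apply]⟩

/-- The power series `∏ᵢ 1 / (1 - μᵢ X)`. -/
def geomProd {ι : Type*} [Fintype ι] (μ : ι → ℂ) : PowerSeries ℂ :=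
  ∏ i, PowerSeries.mk fun k => μ i ^ k

/-- The trace of `w` on the homogeneous polynomials of degree `d` is the coefficient of `X ^ d` in
`1 / det (1 - X w⁻¹)`. -/
lemma trace_polyPiece {n : ℕ} {w : GLV n} {b : Module.Basis (Fin n) ℂ (V n)} {c : Fin n → ℂ}
    (h : ∀ i, (w : Module.End ℂ (V n)) (b i) = c i • b i) (d : ℕ) :
    LinearMap.trace ℂ _ (polyPiece w d) = PowerSeries.coeff d (geomProd fun i => (c i)⁻¹) := by
  -- Conjugate by the matrix of eigenvectors, to reduce to a diagonal matrix.
  let P : GLV n := LinearMap.GeneralLinearGroup.ofLinearEquiv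
    ((Pi.basisFun ℂ (Fin n)).equiv b (Equiv.refl _))
  have hP : ∀ i, (P : Module.End ℂ (V n)) (Pi.single i 1) = b i := fun i => by
    have := (Pi.basisFun ℂ (Fin n)).equiv_apply i b (Equiv.refl _)
    rwa [Pi.basisFun_apply] at this
  have hP' : ∀ i, ((P⁻¹ : GLV n) : Module.End ℂ (V n)) (b i) = Pi.single i 1 := fun i => by
    rw [← hP, ← Module.End.mul_apply, ← Units.val_mul, inv_mul_cancel]; rfl
  have hw' : ∀ i, ((w⁻¹ : GLV n) : Module.End ℂ (V n)) (b i) = (c i)⁻¹ • b i := fun i => by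
    have h1 : ((w⁻¹ : GLV n) : Module.End ℂ (V n)) ((w : Module.End ℂ (V n)) (b i)) = b i := by
      rw [← Module.End.mul_apply, ← Units.val_mul, inv_mul_cancel]; rfl
    rw [h, map_smul] at h1
    have h0 : c i ≠ 0 := fun h0 => b.ne_zero i (by rw [← h1, h0, zero_smul])
    conv_rhs => rw [← h1]
    rw [smul_smul, inv_mul_cancel₀ h0, one_smul]
  obtain ⟨D, hDdef⟩ : ∃ D : GLV n, D = P⁻¹ * (w * P) := ⟨_, rfl⟩
  have hconj : LinearMap.trace ℂ _ (polyPiece w d) = LinearMap.trace ℂ _ (polyPiece D d) := by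
    rw [hDdef, polyPiece_mul P⁻¹, LinearMap.trace_mul_comm, ← polyPiece_mul, mul_assoc,
      mul_inv_cancel, mul_one]
  have hD : ∀ i, polyAct D (MvPolynomial.X i) = (c i)⁻¹ • MvPolynomial.X i := fun i => by
    have : ∀ j, ((D⁻¹ : GLV n) : Module.End ℂ (V n)) (Pi.single j 1) =
        (c j)⁻¹ • Pi.single j 1 := fun j => by
      have hDinv : D⁻¹ = P⁻¹ * w⁻¹ * P := by rw [hDdef]; group
      rw [hDinv, Units.val_mul, Units.val_mul, Module.End.mul_apply, Module.End.mul_apply, hP, hw',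
        map_smul, hP']
    rw [polyAct, MvPolynomial.aeval_X, Finset.sum_eq_single i]
    · rw [this, Pi.smul_apply, Pi.single_eq_same, smul_eq_mul, mul_one, MvPolynomial.smul_eq_C_mul]
    · intro j _ hji
      rw [this, Pi.smul_apply, Pi.single_eq_of_ne (Ne.symm hji), smul_zero, map_zero, zero_mul]
    · exact fun hi => (hi (Finset.mem_univ i)).elim
  obtain ⟨B, hB⟩ := exists_monomial_basis n d
  rw [hconj, trace_eq_sum_of_apply_basis B _ fun u => ∏ i, (c i)⁻¹ ^ ((u : Fin n →₀ ℕ) i)]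
  · rw [geomProd, PowerSeries.coeff_prod, Finset.sum_coe_sort _ fun u : Fin n →₀ ℕ =>
      ∏ i, (c i)⁻¹ ^ (u i)]
    simp only [PowerSeries.coeff_mk]
  · intro u
    ext1
    change polyAct D (B u : S n) = _ • (B u : S n)
    rw [hB, MvPolynomial.monomial_eq, Finsupp.prod_fintype _ _ fun i => pow_zero _, map_one, one_mul,
      map_prod]
    simp only [map_pow, hD, smul_pow]
    rw [Finset.prod_smul]

/-- The Hilbert series `∑_d dim (S^d(V*) ⊗ U)^W X^d` of `(S(V*) ⊗ U)^W`. -/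
def hilbTensor {n : ℕ} (W : Subgroup (GLV n)) {U : Type} [AddCommGroup U] [Module ℂ U]
    (ρ : Representation ℂ W U) : PowerSeries ℂ :=
  PowerSeries.mk fun d => (Module.finrank ℂ
    ((invTensor W ρ).restrictScalars ℂ ⊓ tensorPiece n U d : Submodule ℂ (S n ⊗[ℂ] U)) : ℂ)

/-- The homogeneous component of degree `d` of the invariant ring. -/
def invPiece {n : ℕ} (W : Subgroup (GLV n)) (d : ℕ) : Submodule ℂ (S n) :=
  Subalgebra.toSubmodule (invRing W) ⊓ MvPolynomial.homogeneousSubmodule (Fin n) ℂ d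

/-- The Hilbert series of the invariant ring. -/
def hilbRing {n : ℕ} (W : Subgroup (GLV n)) : PowerSeries ℂ :=
  PowerSeries.mk fun d => (Module.finrank ℂ (invPiece W d) : ℂ)

instance {n d : ℕ} : FiniteDimensional ℂ (MvPolynomial.homogeneousSubmodule (Fin n) ℂ d) :=
  Module.Finite.of_basis (exists_monomial_basis n d).choose

instance {n d : ℕ} (W : Subgroup (GLV n)) : FiniteDimensional ℂ (invPiece W d) :=
  Submodule.finiteDimensional_of_le (inf_le_right :
    invPiece W d ≤ MvPolynomial.homogeneousSubmodule (Fin n) ℂ d)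

lemma finrank_invariants_pieceRep {n : ℕ} (W : Subgroup (GLV n)) (d : ℕ) :
    Module.finrank ℂ (pieceRep W d).invariants = Module.finrank ℂ (invPiece W d) := by
  have h : (pieceRep W d).invariants.map (MvPolynomial.homogeneousSubmodule (Fin n) ℂ d).subtype =
      invPiece W d := by
    ext f
    constructor
    · rintro ⟨g, hg, rfl⟩
      exact ⟨fun w hw => congrArg Subtype.val (hg ⟨w, hw⟩), g.2⟩
    · rintro ⟨hf, hfd⟩
      exact ⟨⟨f, hfd⟩, fun w => Subtype.ext (hf w w.2), rfl⟩
  rw [← h]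
  exact (Submodule.equivMapOfInjective _ (Submodule.subtype_injective _) _).finrank_eq

lemma finrank_invariants_tprod {n : ℕ} (W : Subgroup (GLV n)) {U : Type} [AddCommGroup U]
    [Module ℂ U] (ρ : Representation ℂ W U) (d : ℕ) :
    Module.finrank ℂ (Representation.invariants
      (V := MvPolynomial.homogeneousSubmodule (Fin n) ℂ d ⊗[ℂ] U) ((pieceRep W d).tprod ρ)) =
      Module.finrank ℂ
        ((invTensor W ρ).restrictScalars ℂ ⊓ tensorPiece n U d : Submodule ℂ (S n ⊗[ℂ] U)) := by
  set j := (MvPolynomial.homogeneousSubmodule (Fin n) ℂ d).subtype.rTensor U with hj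
  have hinj : Function.Injective j :=
    Module.Flat.rTensor_preserves_injective_linearMap _ (Submodule.subtype_injective _)
  have hcomm : ∀ (w : W) x, j (((pieceRep W d).tprod ρ) w x) = ((polyRep W).tprod ρ) w (j x) := by
    intro w x
    induction x using TensorProduct.induction_on with
    | zero => simp
    | tmul f u => rfl
    | add x y hx hy => simp only [map_add, hx, hy]
  have h : (Representation.invariants
      (V := MvPolynomial.homogeneousSubmodule (Fin n) ℂ d ⊗[ℂ] U) ((pieceRep W d).tprod ρ)).map j =
      (invTensor W ρ).restrictScalars ℂ ⊓ tensorPiece n U d := by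
    ext t
    constructor
    · rintro ⟨x, hx, rfl⟩
      exact ⟨fun w => by rw [← hcomm, hx w], ⟨x, rfl⟩⟩
    · rintro ⟨ht, x, rfl⟩
      exact ⟨x, fun w => hinj ((hcomm w x).trans (ht w)), rfl⟩
  rw [← h]
  exact (Submodule.equivMapOfInjective _ hinj _).finrank_eq

lemma sum_trace_eq_card_mul_finrank_invariants {G M : Type*} [Group G] [Fintype G] [AddCommGroup M]
    [Module ℂ M] [FiniteDimensional ℂ M] (σ : Representation ℂ G M) :
    ∑ g, LinearMap.trace ℂ M (σ g) = (Nat.card G : ℂ) * Module.finrank ℂ σ.invariants := by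
  have hne : (Nat.card G : ℂ) ≠ 0 := Nat.cast_ne_zero.2 Nat.card_pos.ne'
  let _ : Invertible (Nat.card G : ℂ) := invertibleOfNonzero hne
  rw [← σ.card_inv_mul_sum_char_eq_finrank, mul_inv_cancel_left₀ hne]
  rfl

/-- Molien's formula for `(S(V*) ⊗ U)^W`, where `c w` lists the eigenvalues of `w` on `V`. -/
lemma molien_tensor {n : ℕ} (W : Subgroup (GLV n)) [Fintype W] {U : Type} [AddCommGroup U]
    [Module ℂ U] [FiniteDimensional ℂ U] (ρ : Representation ℂ W U)
    (b : W → Module.Basis (Fin n) ℂ (V n)) (c : W → Fin n → ℂ)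
    (h : ∀ (w : W) i, ((w : GLV n) : Module.End ℂ (V n)) (b w i) = c w i • b w i) :
    ∑ w : W, PowerSeries.C (LinearMap.trace ℂ U (ρ w)) * geomProd (fun i => (c w i)⁻¹) =
      PowerSeries.C (Nat.card W : ℂ) * hilbTensor W ρ := by
  ext d
  rw [map_sum, PowerSeries.coeff_C_mul, hilbTensor, PowerSeries.coeff_mk,
    ← finrank_invariants_tprod, ← sum_trace_eq_card_mul_finrank_invariants]
  refine Finset.sum_congr rfl fun w _ => ?_
  rw [PowerSeries.coeff_C_mul, ← trace_polyPiece (h w), mul_comm]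
  exact (LinearMap.trace_tensorProduct' (R := ℂ) (polyPiece (w : GLV n) d) (ρ w)).symm

/-- Molien's formula for the invariant ring. -/
lemma molien_ring {n : ℕ} (W : Subgroup (GLV n)) [Fintype W]
    (b : W → Module.Basis (Fin n) ℂ (V n)) (c : W → Fin n → ℂ)
    (h : ∀ (w : W) i, ((w : GLV n) : Module.End ℂ (V n)) (b w i) = c w i • b w i) :
    ∑ w : W, geomProd (fun i => (c w i)⁻¹) = PowerSeries.C (Nat.card W : ℂ) * hilbRing W := by
  ext d
  rw [map_sum, PowerSeries.coeff_C_mul, hilbRing, PowerSeries.coeff_mk,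
    ← finrank_invariants_pieceRep, ← sum_trace_eq_card_mul_finrank_invariants]
  exact Finset.sum_congr rfl fun w _ => (trace_polyPiece (h w) d).symm

lemma IsHomogeneousBasis.linearIndependent_and_span {n m : ℕ} {W : Subgroup (GLV n)} {U : Type}
    [AddCommGroup U] [Module ℂ U] {ρ : Representation ℂ W U} {b : Fin m → S n ⊗[ℂ] U} {d : Fin m → ℕ}
    (hb : IsHomogeneousBasis W ρ b d) :
    (∀ i, b i ∈ invTensor W ρ) ∧ LinearIndependent (invRing W) b ∧
      ∀ t ∈ invTensor W ρ, ∃ g : Fin m → invRing W, ∑ i, g i • b i = t := by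
  obtain ⟨⟨B, hB⟩, -⟩ := hb
  have key : (invTensor W ρ).subtype ∘ₗ B.repr.symm.toLinearMap =
      Finsupp.linearCombination (invRing W) b := by
    refine Finsupp.lhom_ext' fun i => LinearMap.ext_ring ?_
    rw [LinearMap.comp_apply, LinearMap.comp_apply, LinearMap.comp_apply, Finsupp.lsingle_apply,
      Finsupp.linearCombination_single, one_smul]
    exact (congrArg _ (B.repr_symm_single_one i)).trans (hB i)
  refine ⟨fun i => hB i ▸ (B i).2, ?_, fun t ht => ⟨fun i => B.repr ⟨t, ht⟩ i, ?_⟩⟩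
  · rw [LinearIndependent, ← key]
    exact Subtype.val_injective.comp B.repr.symm.injective
  · have h := LinearMap.congr_fun key (B.repr ⟨t, ht⟩)
    rw [Finsupp.linearCombination_apply, Finsupp.sum_fintype _ _ (by simp)] at h
    rw [← h]
    exact congrArg Subtype.val (B.repr.symm_apply_apply ⟨t, ht⟩)

/-- A homogeneous basis with degrees `d i` exhibits `(S(V*) ⊗ U)^W` as the sum of copies of
`S(V*)^W` shifted by the `d i`. -/
lemma hilbTensor_eq {n m : ℕ} {W : Subgroup (GLV n)} {U : Type} [AddCommGroup U] [Module ℂ U]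
    {ρ : Representation ℂ W U} {b : Fin m → S n ⊗[ℂ] U} {d : Fin m → ℕ}
    (hb : IsHomogeneousBasis W ρ b d) :
    hilbTensor W ρ = (∑ i, PowerSeries.X ^ d i) * hilbRing W := by
  obtain ⟨hmem, hli, hspan⟩ := hb.linearIndependent_and_span
  have hd := hb.2
  ext D
  rw [Finset.sum_mul, map_sum]
  simp only [PowerSeries.coeff_X_pow_mul', hilbTensor, hilbRing, PowerSeries.coeff_mk]
  -- In degree `D` the basis identifies the invariants with `∏ᵢ (S^(D - d i))^W`, the factors with
  -- `d i > D` being zero.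
  let X : Fin m → Submodule ℂ (S n) := fun i => if d i ≤ D then invPiece W (D - d i) else ⊥
  have hXinv : ∀ i, ∀ f ∈ X i, f ∈ invRing W := fun i f hf => by
    by_cases h : d i ≤ D
    · rw [show X i = _ from if_pos h] at hf; exact hf.1
    · rw [show X i = _ from if_neg h] at hf; rw [(Submodule.mem_bot ℂ).1 hf]; exact zero_mem _
  have hXfin : ∀ i, FiniteDimensional ℂ (X i) := fun i => by
    by_cases h : d i ≤ D
    · rw [show X i = _ from if_pos h]; infer_instance
    · rw [show X i = _ from if_neg h]; infer_instance
  have hXrank : ∀ i, (Module.finrank ℂ (X i) : ℂ) =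
      if d i ≤ D then (Module.finrank ℂ (invPiece W (D - d i)) : ℂ) else 0 := fun i => by
    by_cases h : d i ≤ D
    · rw [show X i = _ from if_pos h, if_pos h]
    · rw [show X i = _ from if_neg h, if_neg h, finrank_bot, Nat.cast_zero]
  let F : (∀ i, X i) →ₗ[ℂ] S n ⊗[ℂ] U :=
    { toFun := fun g => ∑ i, (g i : S n) • b i
      map_add' := fun g g' => by simp [add_smul, Finset.sum_add_distrib]
      map_smul' := fun a g => by simp [Finset.smul_sum] }
  have hF : Function.Injective F := by
    rw [← LinearMap.ker_eq_bot, LinearMap.ker_eq_bot']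
    intro g hg
    have := Fintype.linearIndependent_iff.1 hli (fun i => ⟨g i, hXinv i _ (g i).2⟩) hg
    exact funext fun i => Subtype.ext (congrArg (fun x : invRing W => (x : S n)) (this i))
  have hrange : LinearMap.range F =
      (invTensor W ρ).restrictScalars ℂ ⊓ tensorPiece n U D := by
    ext t
    constructor
    · rintro ⟨g, rfl⟩
      change ∑ i, (g i : S n) • b i ∈ _
      refine sum_mem fun i _ => Submodule.mem_inf.2
        ⟨(invTensor W ρ).smul_mem ⟨g i, hXinv i _ (g i).2⟩ (hmem i), ?_⟩
      have hgi := (g i).2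
      generalize (g i : S n) = f at hgi ⊢
      by_cases h : d i ≤ D
      · rw [show X i = _ from if_pos h] at hgi
        have := smul_mem_tensorPiece hgi.2 (hd i)
        rwa [Nat.sub_add_cancel h] at this
      · rw [show X i = _ from if_neg h] at hgi
        rw [(Submodule.mem_bot ℂ).1 hgi, zero_smul]
        exact zero_mem _
    · rintro ⟨ht, htD⟩
      obtain ⟨g, rfl⟩ := hspan t ht
      let g' : ∀ i, X i := fun i => ⟨if d i ≤ D then
        MvPolynomial.homogeneousComponent (D - d i) (g i : S n) else 0, by
        by_cases h : d i ≤ D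
        · rw [show X i = _ from if_pos h, if_pos h]
          exact ⟨homogeneousComponent_mem_invRing (g i).2 _,
            MvPolynomial.homogeneousComponent_isHomogeneous _ _⟩
        · rw [if_neg h]; exact zero_mem _⟩
      have h1 := tensorComponent_of_mem htD D
      rw [if_pos rfl, map_sum] at h1
      refine ⟨g', ?_⟩
      rw [← h1]
      change ∑ i, (g' i : S n) • b i = _
      refine Finset.sum_congr rfl fun i _ => ?_
      refine Eq.trans ?_ (tensorComponent_smul_of_mem (g i : S n) (hd i) D).symm
      simp only [g']
      split_ifs <;> simp
  rw [← hrange, LinearMap.finrank_range_of_inj hF, Module.finrank_pi_fintype, Nat.cast_sum]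
  exact Finset.sum_congr rfl fun i _ => hXrank i

/-! ### The Hilbert series of the invariant ring and expansions at `1` -/

lemma mk_dvd_mul_one_sub_X_pow {d : ℕ} (hd : 0 < d) :
    (PowerSeries.mk fun k => if d ∣ k then (1 : ℂ) else 0) * (1 - PowerSeries.X ^ d) = 1 := by
  ext k
  rw [mul_sub, mul_one, map_sub, PowerSeries.coeff_mul_X_pow', PowerSeries.coeff_mk,
    PowerSeries.coeff_one]
  by_cases h : d ≤ k
  · have hk : k ≠ 0 := by omega
    have : d ∣ k - d ↔ d ∣ k := by rw [Nat.dvd_sub_iff_left h dvd_rfl]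
    simp only [if_pos h, PowerSeries.coeff_mk, this, sub_self, if_neg hk]
  · rw [if_neg h, sub_zero]
    by_cases hk : k = 0
    · simp [hk]
    · rw [if_neg hk, if_neg fun h' => h (Nat.le_of_dvd (by omega) h')]

/-- The monomials in basic invariants form a homogeneous basis of the invariant ring, so that its
Hilbert series is `∏ᵢ 1 / (1 - X ^ dᵢ)`. -/
lemma IsBasicInvariants.hilbRing_mul {n : ℕ} {W : Subgroup (GLV n)} {f : Fin n → S n}
    {d : Fin n → ℕ} (hf : IsBasicInvariants W f d) (hd : ∀ i, 0 < d i) :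
    hilbRing W * ∏ i, (1 - PowerSeries.X ^ d i) = 1 := by
  obtain ⟨hhom, hind, hgen⟩ := hf
  have hmon : ∀ u : Fin n →₀ ℕ, (MvPolynomial.aeval f (MvPolynomial.monomial u (1 : ℂ)) : S n) =
      ∏ i, f i ^ u i := fun u => by
    rw [MvPolynomial.aeval_monomial, map_one, one_mul, Finsupp.prod_fintype _ _ fun i => pow_zero _]
  have hmonhom : ∀ u : Fin n →₀ ℕ, (∏ i, f i ^ u i).IsHomogeneous (∑ i, d i * u i) := fun u =>
    MvPolynomial.IsHomogeneous.prod _ _ _ fun i _ => (hhom i).pow _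
  suffices h : hilbRing W = ∏ i, PowerSeries.mk fun k => if d i ∣ k then (1 : ℂ) else 0 by
    rw [h, ← Finset.prod_mul_distrib]
    exact Finset.prod_eq_one fun i _ => mk_dvd_mul_one_sub_X_pow (hd i)
  ext D
  rw [hilbRing, PowerSeries.coeff_mk, PowerSeries.coeff_prod]
  simp only [PowerSeries.coeff_mk, Finset.prod_ite_zero, Finset.prod_const_one, Finset.sum_boole]
  set A := (Finset.univ.finsuppAntidiag D).filter fun l : Fin n →₀ ℕ =>
    ∀ i ∈ Finset.univ, d i ∣ l i with hA
  have hAmem : ∀ l : A, (∑ i, (l : Fin n →₀ ℕ) i = D) ∧ ∀ i, d i ∣ (l : Fin n →₀ ℕ) i := fun l => by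
    have := (Finset.mem_filter.1 l.2)
    exact ⟨(Finset.mem_finsuppAntidiag.1 this.1).1, fun i => this.2 i (Finset.mem_univ i)⟩
  let e : A → (Fin n →₀ ℕ) := fun l =>
    Finsupp.equivFunOnFinite.symm fun i => (l : Fin n →₀ ℕ) i / d i
  have he : ∀ l i, d i * e l i = (l : Fin n →₀ ℕ) i := fun l i =>
    Nat.mul_div_cancel' ((hAmem l).2 i)
  have hinj : Function.Injective e := fun l l' h => Subtype.ext (Finsupp.ext fun i => by
    rw [← he, ← he, h])
  let v : A → S n := fun l => ∏ i, f i ^ e l i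
  have hv : LinearIndependent ℂ v := by
    have h1 := ((MvPolynomial.basisMonomials (Fin n) ℂ).linearIndependent.comp e hinj).map'
      (MvPolynomial.aeval f).toLinearMap (LinearMap.ker_eq_bot.2 hind)
    have h2 : (MvPolynomial.aeval f).toLinearMap ∘ MvPolynomial.basisMonomials (Fin n) ℂ ∘ e = v :=
      funext fun l => by
        rw [MvPolynomial.coe_basisMonomials]
        exact hmon _
    rwa [h2] at h1
  have hspan : invPiece W D = Submodule.span ℂ (Set.range v) := by
    refine le_antisymm ?_ (Submodule.span_le.2 ?_)
    · rintro x ⟨hx, hxD⟩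
      have hx' : x ∈ Algebra.adjoin ℂ (Set.range f) := by rw [hgen]; exact hx
      rw [Algebra.adjoin_range_eq_range_aeval] at hx'
      obtain ⟨P, rfl⟩ := hx'
      have h1 := MvPolynomial.homogeneousComponent_of_mem (m := D) hxD
      rw [if_pos rfl] at h1
      change MvPolynomial.aeval f P ∈ _
      rw [show MvPolynomial.aeval f P = _ from h1.symm]
      change MvPolynomial.homogeneousComponent D (MvPolynomial.aeval f P) ∈ _
      rw [P.as_sum, map_sum, map_sum]
      refine sum_mem fun u _ => ?_
      rw [← mul_one (MvPolynomial.coeff u P), ← smul_eq_mul, ← MvPolynomial.smul_monomial, map_smul,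
        map_smul, hmon, MvPolynomial.homogeneousComponent_of_mem (hmonhom u)]
      refine Submodule.smul_mem _ _ ?_
      split_ifs with h
      · refine Submodule.subset_span ⟨⟨Finsupp.equivFunOnFinite.symm fun i => d i * u i, ?_⟩, ?_⟩
        · rw [hA, Finset.mem_filter, Finset.mem_finsuppAntidiag]
          exact ⟨⟨h.symm, Finset.subset_univ _⟩, fun i _ => Dvd.intro _ rfl⟩
        · refine Finset.prod_congr rfl fun i _ => ?_
          simp only [e, Finsupp.equivFunOnFinite_symm_apply_apply, Nat.mul_div_cancel_left _ (hd i)]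
      · exact zero_mem _
    · rintro _ ⟨l, rfl⟩
      refine ⟨?_, ?_⟩
      · change v l ∈ invRing W
        rw [← hgen]
        exact prod_mem fun i _ => pow_mem (Algebra.subset_adjoin (Set.mem_range_self i)) _
      · have := hmonhom (e l)
        simp only [he, (hAmem l).1] at this
        exact this
  rw [hspan, finrank_span_eq_card hv, Fintype.card_coe]

/-- The polynomial identity obtained by clearing denominators in
`∑ Q i / ((1 - X) ^ k i * g i) = 0`. -/
lemma sum_mul_prod_erase_eq_zero {ι : Type*} [Fintype ι] [DecidableEq ι] {n : ℕ}
    {Q g : ι → Polynomial ℂ} {k : ι → ℕ} {T : ι → PowerSeries ℂ} (hk : ∀ i, k i ≤ n)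
    (hT : ∀ i, T i * (((1 - Polynomial.X) ^ k i * g i : Polynomial ℂ) : PowerSeries ℂ) = 1)
    (hsum : ∑ i, (Q i : PowerSeries ℂ) * T i = 0) :
    ∑ i, Q i * (1 - Polynomial.X) ^ (n - k i) * ∏ j ∈ Finset.univ.erase i, g j = 0 := by
  apply Polynomial.coe_injective ℂ
  rw [Polynomial.coe_zero]
  have h1 : ∑ i, (Q i : PowerSeries ℂ) * T i *
      (((1 - Polynomial.X) ^ n * ∏ j, g j : Polynomial ℂ) : PowerSeries ℂ) = 0 := by
    rw [← Finset.sum_mul, hsum, zero_mul]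
  rw [← Polynomial.coeToPowerSeries.ringHom_apply, map_sum, ← h1]
  refine Finset.sum_congr rfl fun i _ => ?_
  have h2 : ((1 - Polynomial.X) ^ n * ∏ j, g j : Polynomial ℂ) = ((1 - Polynomial.X) ^ k i * g i) *
      ((1 - Polynomial.X) ^ (n - k i) * ∏ j ∈ Finset.univ.erase i, g j) := by
    rw [← Finset.mul_prod_erase _ _ (Finset.mem_univ i), ← Nat.add_sub_cancel' (hk i), pow_add,
      Nat.add_sub_cancel_left]
    ring
  rw [h2, Polynomial.coe_mul _ (_ * ∏ j ∈ _, _), mul_assoc (Q i : PowerSeries ℂ) (T i),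
    ← mul_assoc (T i), hT i, one_mul,
    mul_assoc, Polynomial.coeToPowerSeries.ringHom_apply, Polynomial.coe_mul]

/-- The coefficients of `(1 - X) ^ (-n)` and `(1 - X) ^ (1 - n)` in the expansion at `1` of a vanishing
sum `∑ Q i / ((1 - X) ^ k i * g i)` with `k i ≤ n`. -/
lemma expansion_at_one {ι : Type*} [Fintype ι] {n : ℕ}
    {Q g : ι → Polynomial ℂ} {k : ι → ℕ} {T : ι → PowerSeries ℂ} (hk : ∀ i, k i ≤ n)
    (hg : ∀ i, (g i).eval 1 ≠ 0)
    (hT : ∀ i, T i * (((1 - Polynomial.X) ^ k i * g i : Polynomial ℂ) : PowerSeries ℂ) = 1)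
    (hsum : ∑ i, (Q i : PowerSeries ℂ) * T i = 0) :
    ∑ i with k i = n, (Q i).eval 1 / (g i).eval 1 = 0 ∧
      ∑ i with k i = n, ((Q i).derivative.eval 1 * (g i).eval 1 -
        (Q i).eval 1 * (g i).derivative.eval 1) / (g i).eval 1 ^ 2 =
      ∑ i with k i + 1 = n, (Q i).eval 1 / (g i).eval 1 := by
  classical
  have hpoly := sum_mul_prod_erase_eq_zero hk hT hsum
  -- After multiplication by `(1 - q) ^ n` the sum is a function that is regular and zero near `1`;
  -- the two assertions are that its value and its derivative at `1` vanish.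
  have hzero : ∀ q : ℂ, (∀ i, (g i).eval q ≠ 0) →
      ∑ i, (Q i).eval q * (1 - q) ^ (n - k i) / (g i).eval q = 0 := by
    intro q hq
    have h1 := congrArg (Polynomial.eval q) hpoly
    rw [Polynomial.eval_finsetSum, Polynomial.eval_zero] at h1
    have hprod : ∏ j, (g j).eval q ≠ 0 := Finset.prod_ne_zero_iff.2 fun j _ => hq j
    rw [← mul_left_inj' hprod, zero_mul, ← h1, Finset.sum_mul]
    refine Finset.sum_congr rfl fun i _ => ?_
    rw [← Finset.mul_prod_erase _ _ (Finset.mem_univ i)]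
    simp only [Polynomial.eval_mul, Polynomial.eval_pow, Polynomial.eval_sub, Polynomial.eval_one,
      Polynomial.eval_X, Polynomial.eval_prod]
    field_simp [hq i]
  constructor
  · have h1 := hzero 1 hg
    refine Eq.trans ?_ h1
    rw [Finset.sum_filter]
    refine Finset.sum_congr rfl fun i _ => ?_
    split_ifs with h
    · rw [h, Nat.sub_self, pow_zero, mul_one]
    · rw [sub_self, zero_pow (by have := hk i; omega), mul_zero, zero_div]
  · have hder : HasDerivAt (fun q : ℂ => ∑ i, (Q i).eval q * (1 - q) ^ (n - k i) / (g i).eval q)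
        (∑ i, ((if k i = n then ((Q i).derivative.eval 1 * (g i).eval 1 -
        (Q i).eval 1 * (g i).derivative.eval 1) / (g i).eval 1 ^ 2 else 0) -
        if k i + 1 = n then (Q i).eval 1 / (g i).eval 1 else 0)) 1 := by
      refine HasDerivAt.fun_sum fun i _ => ?_
      have hQ := (Q i).hasDerivAt (1 : ℂ)
      have hgi := (g i).hasDerivAt (1 : ℂ)
      have hp := ((hasDerivAt_id (1 : ℂ)).const_sub 1).fun_pow (n - k i)
      refine ((hQ.mul hp).div hgi (hg i)).congr_deriv ?_
      have h0 := hg i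
      by_cases h : k i = n
      · rw [if_pos h, if_neg (by omega), h, Nat.sub_self]
        simp
      · by_cases h' : k i + 1 = n
        · have : n - k i = 1 := by omega
          rw [if_neg h, if_pos h', this]
          simp
          field_simp
        · obtain ⟨m, hm⟩ : ∃ m, n - k i = m + 2 := ⟨n - k i - 2, by have := hk i; omega⟩
          rw [if_neg h, if_neg h', hm]
          simp
    have hev : (fun q : ℂ => ∑ i, (Q i).eval q * (1 - q) ^ (n - k i) / (g i).eval q) =ᶠ[nhds 1]
        fun _ => 0 := by
      have : ∀ᶠ q in nhds (1 : ℂ), ∀ i, (g i).eval q ≠ 0 :=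
        Filter.eventually_all.2 fun i => (g i).continuous.continuousAt.eventually_ne (hg i)
      exact this.mono hzero
    have h1 := (hder.congr_of_eventuallyEq hev.symm).unique (hasDerivAt_const _ _)
    rw [Finset.sum_sub_distrib, sub_eq_zero, ← Finset.sum_filter, ← Finset.sum_filter] at h1
    exact h1

/-- The part of `∏ᵢ (1 - μᵢ X)` that does not vanish at `1`. -/
def unitPart {ι : Type*} [Fintype ι] (μ : ι → ℂ) : Polynomial ℂ :=
  ∏ i with μ i ≠ 1, (1 - Polynomial.C (μ i) * Polynomial.X)

lemma eval_one_unitPart {ι : Type*} [Fintype ι] (μ : ι → ℂ) :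
    (unitPart μ).eval 1 = ∏ i with μ i ≠ 1, (1 - μ i) := by
  simp [unitPart, Polynomial.eval_prod]

lemma eval_one_unitPart_ne_zero {ι : Type*} [Fintype ι] (μ : ι → ℂ) : (unitPart μ).eval 1 ≠ 0 := by
  rw [eval_one_unitPart]
  exact Finset.prod_ne_zero_iff.2 fun i hi => sub_ne_zero.2 (Finset.mem_filter.1 hi).2.symm

lemma geomProd_mul {ι : Type*} [Fintype ι] (μ : ι → ℂ) :
    geomProd μ * (((1 - Polynomial.X) ^ (Finset.univ.filter fun i => μ i = 1).card *
      unitPart μ : Polynomial ℂ) : PowerSeries ℂ) = 1 := by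
  have h1 : ((1 - Polynomial.X) ^ (Finset.univ.filter fun i => μ i = 1).card *
      unitPart μ : Polynomial ℂ) = ∏ i, (1 - Polynomial.C (μ i) * Polynomial.X) := by
    rw [← Finset.prod_filter_mul_prod_filter_not Finset.univ (fun i => μ i = 1), unitPart,
      ← Finset.prod_const]
    congr 1
    exact Finset.prod_congr rfl fun i hi => by
      rw [(Finset.mem_filter.1 hi).2, map_one, one_mul]
  rw [h1, geomProd, ← Polynomial.coeToPowerSeries.ringHom_apply, map_prod,
    ← Finset.prod_mul_distrib]
  refine Finset.prod_eq_one fun i _ => ?_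
  rw [Polynomial.coeToPowerSeries.ringHom_apply]
  ext k
  simp only [Polynomial.coe_sub, Polynomial.coe_one, Polynomial.coe_mul, Polynomial.coe_C,
    Polynomial.coe_X, mul_sub, mul_one, map_sub, PowerSeries.coeff_mk, PowerSeries.coeff_one]
  rw [mul_left_comm, PowerSeries.coeff_C_mul]
  cases k with
  | zero => simp
  | succ k =>
    rw [PowerSeries.coeff_succ_mul_X, PowerSeries.coeff_mk, if_neg (Nat.succ_ne_zero k), pow_succ]
    ring

/-! ### Sums over the reflections of `W` -/

/-- The determinant of `g`, as a complex number. -/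
def detV {n : ℕ} (g : GLV n) : ℂ := LinearMap.det (g : Module.End ℂ (V n))

lemma detV_mul {n : ℕ} (g h : GLV n) : detV (g * h) = detV g * detV h := by
  rw [detV, Units.val_mul, map_mul]; rfl

lemma detV_one {n : ℕ} : detV (1 : GLV n) = 1 := by
  rw [detV, Units.val_one, map_one]

lemma detV_inv {n : ℕ} (g : GLV n) : detV g⁻¹ = (detV g)⁻¹ :=
  eq_inv_of_mul_eq_one_left (by rw [← detV_mul, inv_mul_cancel, detV_one])

section Eigenbasis

variable {n : ℕ} {w : GLV n} {b : Module.Basis (Fin n) ℂ (V n)} {c : Fin n → ℂ}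

lemma detV_eq_prod (h : ∀ i, (w : Module.End ℂ (V n)) (b i) = c i • b i) : detV w = ∏ i, c i := by
  rw [detV, ← LinearMap.det_toMatrix b, ← Matrix.det_diagonal]
  congr 1
  ext i j
  rw [LinearMap.toMatrix_apply, h, map_smul, Finsupp.smul_apply, Module.Basis.repr_self,
    Matrix.diagonal_apply, Finsupp.single_apply, smul_eq_mul]
  by_cases hij : i = j
  · rw [if_pos hij, if_pos hij.symm, mul_one, hij]
  · rw [if_neg hij, if_neg (Ne.symm hij), mul_zero]

lemma finrank_fixedSpace (h : ∀ i, (w : Module.End ℂ (V n)) (b i) = c i • b i) :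
    Module.finrank ℂ (fixedSpace w) = (Finset.univ.filter fun i => c i = 1).card := by
  have hspan : fixedSpace w = Submodule.span ℂ (Set.range fun i : {i // c i = 1} => b i) := by
    refine le_antisymm (fun v hv => ?_) (Submodule.span_le.2 ?_)
    · rw [fixedSpace, LinearMap.mem_ker, LinearMap.sub_apply, Module.End.one_apply,
        sub_eq_zero] at hv
      have h1 : ∀ i, b.repr v i * c i = b.repr v i := fun i => by
        have h2 : (w : Module.End ℂ (V n)) v = ∑ i, (b.repr v i * c i) • b i := by
          conv_lhs => rw [← b.sum_repr v, map_sum]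
          exact Finset.sum_congr rfl fun i _ => by rw [map_smul, h, smul_smul]
        have h3 := congrArg (fun x => b.repr x i) h2
        simp only [hv] at h3
        rw [Module.Basis.repr_sum_self] at h3
        exact h3.symm
      rw [← b.sum_repr v]
      refine sum_mem fun i _ => ?_
      by_cases hi : c i = 1
      · exact Submodule.smul_mem _ _ (Submodule.subset_span ⟨⟨i, hi⟩, rfl⟩)
      · have : b.repr v i = 0 := by
          by_contra h0
          exact hi (mul_left_cancel₀ h0 ((h1 i).trans (mul_one _).symm))
        rw [this, zero_smul]
        exact zero_mem _
    · rintro _ ⟨⟨i, hi⟩, rfl⟩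
      rw [SetLike.mem_coe, fixedSpace, LinearMap.mem_ker, LinearMap.sub_apply,
        Module.End.one_apply, h, hi, one_smul, sub_self]
  rw [hspan, ← Fintype.card_subtype]
  exact finrank_span_eq_card (b.linearIndependent.comp _ Subtype.val_injective)

lemma card_eigenvalue_one_le (c : Fin n → ℂ) : (Finset.univ.filter fun i => c i = 1).card ≤ n :=
  (Finset.card_le_univ _).trans (Fintype.card_fin n).le

lemma eq_one_iff_card_eigenvalue_one (h : ∀ i, (w : Module.End ℂ (V n)) (b i) = c i • b i) :
    (Finset.univ.filter fun i => c i = 1).card = n ↔ w = 1 := by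
  constructor
  · intro hc
    have hall : ∀ i, c i = 1 := fun i => by
      have : (Finset.univ.filter fun i => c i = 1) = Finset.univ :=
        (Finset.card_eq_iff_eq_univ _).1 (by rw [hc, Fintype.card_fin])
      exact Finset.filter_eq_self.1 this i (Finset.mem_univ i)
    refine Units.ext (b.ext fun i => ?_)
    rw [h, hall, one_smul]; rfl
  · rintro rfl
    have hall : ∀ i, c i = 1 := fun i => by
      have h1 := h i
      have h2 : (1 : ℂ) • b i = c i • b i := by rw [← h1, one_smul]; rfl
      exact (smul_left_injective ℂ (b.ne_zero i) h2).symm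
    rw [Finset.filter_true_of_mem fun i _ => hall i, Finset.card_univ, Fintype.card_fin]

/-- A reflection has a single eigenvalue different from `1`, which is its determinant. -/
lemma IsReflection.exists_index (hw : IsReflection w)
    (h : ∀ i, (w : Module.End ℂ (V n)) (b i) = c i • b i) :
    ∃ i₀, c i₀ ≠ 1 ∧ c i₀ = detV w ∧ ∀ i, i ≠ i₀ → c i = 1 := by
  have h1 : Module.finrank ℂ (fixedSpace w) + 1 = n := hw
  rw [finrank_fixedSpace h] at h1
  have h2 := Finset.card_filter_add_card_filter_not (s := (Finset.univ : Finset (Fin n)))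
    (fun i => c i = 1)
  rw [Finset.card_univ, Fintype.card_fin] at h2
  obtain ⟨i₀, hi₀⟩ := Finset.card_eq_one.1 (show (Finset.univ.filter fun i => ¬ c i = 1).card = 1 by
    omega)
  have hother : ∀ i, i ≠ i₀ → c i = 1 := fun i hi => by
    by_contra hne
    exact hi (Finset.mem_singleton.1 (hi₀ ▸ Finset.mem_filter.2 ⟨Finset.mem_univ i, hne⟩))
  refine ⟨i₀, (Finset.mem_filter.1 (hi₀.ge (Finset.mem_singleton_self i₀))).2, ?_, hother⟩
  rw [detV_eq_prod h, Finset.prod_eq_single i₀ (fun i _ => hother i)]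
  exact fun h' => (h' (Finset.mem_univ _)).elim

end Eigenbasis

lemma isReflection_inv {n : ℕ} {w : GLV n} (hw : IsReflection w) : IsReflection w⁻¹ := by
  rw [IsReflection, fixedSpace_inv]; exact hw

lemma detV_ne_zero {n : ℕ} (w : GLV n) : detV w ≠ 0 := fun h => by
  have := detV_mul w w⁻¹
  rw [mul_inv_cancel, detV_one, h, zero_mul] at this
  exact one_ne_zero this

lemma IsReflection.detV_ne_one {n : ℕ} {W : Subgroup (GLV n)} [Finite W] {w : GLV n} (hw : w ∈ W)
    (hr : IsReflection w) : detV w ≠ 1 := by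
  obtain ⟨b, c, h⟩ := exists_eigenbasis hw
  obtain ⟨i₀, h1, h2, -⟩ := hr.exists_index h
  rwa [← h2]

open Classical in
/-- The finite set of the reflections of `W`. -/
def reflections {n : ℕ} (W : Subgroup (GLV n)) [Fintype W] : Finset W :=
  Finset.univ.filter fun w => IsReflection (w : GLV n)

lemma mem_reflections {n : ℕ} {W : Subgroup (GLV n)} [Fintype W] {w : W} :
    w ∈ reflections W ↔ IsReflection (w : GLV n) := by simp [reflections]

lemma coe_image_reflections {n : ℕ} (W : Subgroup (GLV n)) [Fintype W] :
    {g : GLV n | g ∈ W ∧ IsReflection g} = Subtype.val '' (reflections W : Set W) := by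
  ext g
  simp [mem_reflections, and_comm]

lemma card_reflections {n : ℕ} (W : Subgroup (GLV n)) [Fintype W] :
    (reflections W).card = numReflections W := by
  rw [numReflections, coe_image_reflections, Set.ncard_image_of_injective _ Subtype.val_injective,
    Set.ncard_coe_finset]

/-- Pairing each reflection with its inverse gives `∑ 1 / (1 - det s⁻¹) = N / 2`. -/
lemma sum_reflections_inv_one_sub {n : ℕ} (W : Subgroup (GLV n)) [Fintype W] :
    2 * ∑ w ∈ reflections W, 1 / (1 - (detV (w : GLV n))⁻¹) = (numReflections W : ℂ) := by
  have h1 : ∑ w ∈ reflections W, 1 / (1 - (detV (w : GLV n))⁻¹) =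
      ∑ w ∈ reflections W, 1 / (1 - detV (w : GLV n)) := by
    refine Finset.sum_nbij' (fun w => w⁻¹) (fun w => w⁻¹) ?_ ?_ ?_ ?_ ?_
    · exact fun w hw => mem_reflections.2 (isReflection_inv (mem_reflections.1 hw))
    · exact fun w hw => mem_reflections.2 (isReflection_inv (mem_reflections.1 hw))
    · exact fun w _ => inv_inv w
    · exact fun w _ => inv_inv w
    · intro w _
      rw [Subgroup.coe_inv, detV_inv]
  rw [two_mul]
  nth_rewrite 2 [h1]
  rw [← Finset.sum_add_distrib, ← card_reflections, Finset.card_eq_sum_ones, Nat.cast_sum]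
  refine Finset.sum_congr rfl fun w hw => ?_
  have h0 := detV_ne_zero (w : GLV n)
  have h2 := (mem_reflections.1 hw).detV_ne_one w.2
  have h3 : 1 - detV (w : GLV n) ≠ 0 := sub_ne_zero.2 h2.symm
  have h4 : detV (w : GLV n) - 1 ≠ 0 := sub_ne_zero.2 h2
  have h5 : 1 - (detV (w : GLV n))⁻¹ = (detV (w : GLV n) - 1) / detV (w : GLV n) := by
    field_simp
  rw [h5, Nat.cast_one, one_div_div, ← neg_sub (detV (w : GLV n)) 1]
  field_simp
  ring

/-- The determinants of the reflections with a given hyperplane sum up to `-1`, because together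
with `1` they are the values of a nontrivial character of the pointwise stabilizer. -/
lemma sum_reflections_fixedSpace_eq {n : ℕ} (W : Subgroup (GLV n)) [Fintype W] [DecidableEq W]
    [DecidableEq (Submodule ℂ (V n))] {H : Submodule ℂ (V n)} {s : W} (hs : s ∈ reflections W)
    (hH : fixedSpace (s : GLV n) = H) :
    ∑ w ∈ (reflections W).filter fun w : W => fixedSpace (w : GLV n) = H, detV (w : GLV n) = -1 := by
  classical
  have hfix : ∀ (w : GLV n) v, v ∈ fixedSpace w ↔ (w : Module.End ℂ (V n)) v = v := fun w v => by
    rw [fixedSpace, LinearMap.mem_ker, LinearMap.sub_apply, Module.End.one_apply, sub_eq_zero]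
  -- The pointwise stabilizer of `H` consists of `1` and the reflections with hyperplane `H`.
  let K : Subgroup W :=
    { carrier := {w | H ≤ fixedSpace (w : GLV n)}
      mul_mem' := fun {x y} hx hy v hv => by
        rw [hfix, Subgroup.coe_mul, Units.val_mul, Module.End.mul_apply, (hfix _ _).1 (hy hv),
          (hfix _ _).1 (hx hv)]
      one_mem' := fun v _ => (hfix _ _).2 rfl
      inv_mem' := fun {x} hx => by
        change H ≤ fixedSpace ((x⁻¹ : W) : GLV n)
        rw [Subgroup.coe_inv, fixedSpace_inv]; exact hx }
  have hsK : s ∈ K := hH.ge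
  let χ : K →* ℂ :=
    { toFun := fun w => detV ((w : W) : GLV n)
      map_one' := detV_one
      map_mul' := fun x y => detV_mul _ _ }
  have hχ : χ ≠ 1 := fun h =>
    (mem_reflections.1 hs).detV_ne_one s.2 (DFunLike.congr_fun h (⟨s, hsK⟩ : K))
  have hsum := sum_hom_units_eq_zero χ hχ
  have h1 : ∑ k : K, χ k = ∑ w : W with w ∈ K, detV (w : GLV n) := by
    exact (Finset.sum_subtype _ (fun w => by simp) fun w : W => detV (w : GLV n)).symm
  have h2 : (Finset.univ.filter fun w : W => w ∈ K) =
      insert 1 ((reflections W).filter fun w : W => fixedSpace (w : GLV n) = H) := by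
    ext w
    rw [Finset.mem_filter, Finset.mem_insert, Finset.mem_filter, mem_reflections]
    constructor
    · rintro ⟨-, hw⟩
      by_cases hw1 : w = 1
      · exact Or.inl hw1
      have hle : H ≤ fixedSpace (w : GLV n) := hw
      have hrankH : Module.finrank ℂ H + 1 = n := hH ▸ mem_reflections.1 hs
      have hne : fixedSpace (w : GLV n) ≠ ⊤ := fun htop => hw1 (Subtype.ext (Units.ext
        (LinearMap.ext fun v => (hfix _ _).1 (htop ▸ Submodule.mem_top))))
      have hlt := Submodule.finrank_lt hne
      rw [Module.finrank_fin_fun] at hlt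
      have hge := Submodule.finrank_mono hle
      have heq : Module.finrank ℂ H = Module.finrank ℂ (fixedSpace (w : GLV n)) := by omega
      exact Or.inr ⟨by rw [IsReflection, ← heq, hrankH],
        (Submodule.eq_of_le_of_finrank_eq hle heq).symm⟩
    · rintro (rfl | ⟨-, hw⟩)
      · exact ⟨Finset.mem_univ _, one_mem K⟩
      · exact ⟨Finset.mem_univ _, hw.ge⟩
  have h3 : (1 : W) ∉ (reflections W).filter fun w : W => fixedSpace (w : GLV n) = H := fun h =>
    (mem_reflections.1 (Finset.mem_filter.1 h).1).detV_ne_one (1 : W).2 detV_one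
  rw [hsum, h2, Finset.sum_insert h3, Subgroup.coe_one, detV_one] at h1
  linear_combination -h1

/-- The determinants of the reflections of `W` sum up to `-N*`. -/
lemma sum_reflections_detV {n : ℕ} (W : Subgroup (GLV n)) [Fintype W] :
    ∑ w ∈ reflections W, detV (w : GLV n) = -(numHyperplanes W : ℂ) := by
  classical
  rw [← Finset.sum_fiberwise_of_maps_to (s := reflections W)
    (t := (reflections W).image fun w : W => fixedSpace (w : GLV n))
    (fun w hw => Finset.mem_image_of_mem _ hw)]
  have h1 : ((reflections W).image fun w : W => fixedSpace (w : GLV n)).card = numHyperplanes W := by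
    rw [numHyperplanes, coe_image_reflections, Set.image_image, ← Set.ncard_coe_finset,
      Finset.coe_image]
  rw [Finset.sum_congr rfl (g := fun _ => (-1 : ℂ)), Finset.sum_const, h1]
  · simp
  · intro H hH
    obtain ⟨s, hs, hsH⟩ := Finset.mem_image.1 hH
    exact sum_reflections_fixedSpace_eq W hs hsH

/-! ### Degree sums -/

lemma card_inv_eigenvalue_one {n : ℕ} (c : Fin n → ℂ) :
    (Finset.univ.filter fun i => (c i)⁻¹ = 1).card = (Finset.univ.filter fun i => c i = 1).card := by
  simp only [inv_eq_one]

lemma unitPart_one {n : ℕ} {W : Subgroup (GLV n)} {b : W → Module.Basis (Fin n) ℂ (V n)}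
    {c : W → Fin n → ℂ}
    (h : ∀ (w : W) i, ((w : GLV n) : Module.End ℂ (V n)) (b w i) = c w i • b w i) :
    unitPart (fun i => (c 1 i)⁻¹) = 1 := by
  have h1 := (eq_one_iff_card_eigenvalue_one (h 1)).2 rfl
  rw [← card_inv_eigenvalue_one] at h1
  have h2 : (Finset.univ.filter fun i => (c 1 i)⁻¹ = 1) = Finset.univ :=
    (Finset.card_eq_iff_eq_univ _).1 (by rw [h1, Fintype.card_fin])
  refine Finset.prod_eq_one fun i hi => ?_
  exact ((Finset.mem_filter.1 hi).2 (Finset.filter_eq_self.1 h2 i (Finset.mem_univ i))).elim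

section DegreeSum

variable {n : ℕ} {W : Subgroup (GLV n)} [Fintype W]
  {b : W → Module.Basis (Fin n) ℂ (V n)} {c : W → Fin n → ℂ}

lemma sum_filter_card_eq (h : ∀ (w : W) i, ((w : GLV n) : Module.End ℂ (V n)) (b w i) =
    c w i • b w i) (F : W → ℂ) :
    ∑ w with (Finset.univ.filter fun i => (c w i)⁻¹ = 1).card = n, F w = F 1 := by
  rw [Finset.sum_eq_single_of_mem (1 : W)]
  · rw [Finset.mem_filter, card_inv_eigenvalue_one]
    exact ⟨Finset.mem_univ _, (eq_one_iff_card_eigenvalue_one (h 1)).2 rfl⟩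
  · intro w hw hw1
    rw [Finset.mem_filter, card_inv_eigenvalue_one, eq_one_iff_card_eigenvalue_one (h w)] at hw
    exact (hw1 (Subtype.ext hw.2)).elim

lemma filter_card_add_one_eq (h : ∀ (w : W) i, ((w : GLV n) : Module.End ℂ (V n)) (b w i) =
    c w i • b w i) :
    (Finset.univ.filter fun w => (Finset.univ.filter fun i => (c w i)⁻¹ = 1).card + 1 = n) =
      reflections W := by
  ext w
  rw [Finset.mem_filter, card_inv_eigenvalue_one, mem_reflections, IsReflection,
    finrank_fixedSpace (h w)]
  simp

lemma eval_unitPart_of_mem_reflections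
    (h : ∀ (w : W) i, ((w : GLV n) : Module.End ℂ (V n)) (b w i) = c w i • b w i) {w : W}
    (hw : w ∈ reflections W) :
    (unitPart fun i => (c w i)⁻¹).eval 1 = 1 - (detV (w : GLV n))⁻¹ := by
  obtain ⟨i₀, h1, h2, h3⟩ := (mem_reflections.1 hw).exists_index (h w)
  rw [eval_one_unitPart, Finset.prod_eq_single_of_mem i₀, h2]
  · exact Finset.mem_filter.2 ⟨Finset.mem_univ _, fun h' => h1 (inv_eq_one.1 h')⟩
  · intro i hi hne
    exact ((Finset.mem_filter.1 hi).2 (by rw [h3 i hne, inv_one])).elim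

/-- The number of elements and the sum of the degrees of a homogeneous basis of `(S(V*) ⊗ U)^W`,
obtained by comparing the expansions at `1` of the two sides of Molien's formula. -/
theorem IsHomogeneousBasis.card_and_sum_degrees {U : Type} [AddCommGroup U] [Module ℂ U]
    [FiniteDimensional ℂ U] {ρ : Representation ℂ W U} {m : ℕ} {β : Fin m → S n ⊗[ℂ] U}
    {d : Fin m → ℕ} (hβ : IsHomogeneousBasis W ρ β d) :
    m = Module.finrank ℂ U ∧ ∑ i, (d i : ℂ) = ∑ w ∈ reflections W,
      (Module.finrank ℂ U - LinearMap.trace ℂ U (ρ w)) / (1 - (detV (w : GLV n))⁻¹) := by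
  choose b c h using fun w : W => exists_eigenbasis w.2
  set P : Polynomial ℂ := ∑ i, Polynomial.X ^ d i with hP
  have hP1 : P.eval 1 = m := by simp [hP, Polynomial.eval_finsetSum]
  have hP' : P.derivative.eval 1 = ∑ i, (d i : ℂ) := by
    simp [hP, Polynomial.eval_finsetSum, Polynomial.derivative_X_pow]
  -- Molien's formula for `(S(V*) ⊗ U)^W` minus `P` times the one for `S(V*)^W`.
  have hsum : ∑ w : W, ((Polynomial.C (LinearMap.trace ℂ U (ρ w)) - P : Polynomial ℂ) :
      PowerSeries ℂ) * geomProd (fun i => (c w i)⁻¹) = 0 := by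
    simp only [Polynomial.coe_sub, Polynomial.coe_C, sub_mul]
    rw [Finset.sum_sub_distrib, molien_tensor W ρ b c h, ← Finset.mul_sum, molien_ring W b c h,
      hilbTensor_eq hβ, hP, ← Polynomial.coeToPowerSeries.ringHom_apply (φ := ∑ i, _), map_sum]
    simp only [Polynomial.coeToPowerSeries.ringHom_apply, Polynomial.coe_pow, Polynomial.coe_X]
    ring
  obtain ⟨h1, h2⟩ := expansion_at_one (n := n)
    (k := fun w : W => (Finset.univ.filter fun i => (c w i)⁻¹ = 1).card)
    (fun w => card_eigenvalue_one_le fun i => (c w i)⁻¹)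
    (fun w => eval_one_unitPart_ne_zero fun i => (c w i)⁻¹)
    (fun w => geomProd_mul fun i => (c w i)⁻¹) hsum
  rw [sum_filter_card_eq h, unitPart_one h] at h1 h2
  have htr : LinearMap.trace ℂ U (ρ 1) = Module.finrank ℂ U := by
    rw [map_one, LinearMap.trace_one]
  simp only [Polynomial.eval_sub, Polynomial.eval_C, Polynomial.eval_one, div_one, htr, hP1,
    sub_eq_zero] at h1
  have hm : m = Module.finrank ℂ U := by exact_mod_cast h1.symm
  refine ⟨hm, ?_⟩
  rw [filter_card_add_one_eq h] at h2
  simp only [Polynomial.derivative_sub, Polynomial.derivative_C, zero_sub, Polynomial.eval_neg,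
    Polynomial.eval_one, Polynomial.derivative_one, Polynomial.eval_zero, mul_zero, sub_zero, mul_one,
    one_pow, div_one, hP'] at h2
  rw [← neg_inj, h2, ← Finset.sum_neg_distrib]
  refine Finset.sum_congr rfl fun w hw => ?_
  rw [eval_unitPart_of_mem_reflections h hw, Polynomial.eval_sub, Polynomial.eval_C, hP1, ← neg_div,
    neg_sub, h1]

/-- The exponents add up to the number of reflections. -/
theorem IsBasicInvariants.sum_exponents {f : Fin n → S n} {e : Fin n → ℕ}
    (hf : IsBasicInvariants W f fun i => e i + 1) : ∑ i, e i = numReflections W := by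
  choose b c h using fun w : W => exists_eigenbasis w.2
  -- `∏ᵢ (1 - X ^ (e i + 1)) = (1 - X) ^ n * G`, with `G'(1) / G(1) = (∑ e i) / 2`.
  set G : Polynomial ℂ := ∏ i : Fin n, ∑ j ∈ Finset.range (e i + 1), Polynomial.X ^ j with hG
  have hGeval : ∀ i, (∑ j ∈ Finset.range (e i + 1), (Polynomial.X : Polynomial ℂ) ^ j).eval 1 =
      (e i : ℂ) + 1 := fun i => by simp [Polynomial.eval_finsetSum]
  have hG1 : G.eval 1 = ∏ i, ((e i : ℂ) + 1) := by
    rw [hG, Polynomial.eval_prod]; exact Finset.prod_congr rfl fun i _ => hGeval i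
  have hG0 : G.eval 1 ≠ 0 := by
    rw [hG1]; exact Finset.prod_ne_zero_iff.2 fun i _ => Nat.cast_add_one_ne_zero _
  have hG' : 2 * G.derivative.eval 1 = G.eval 1 * ∑ i, (e i : ℂ) := by
    rw [hG, Polynomial.derivative_prod_finset, Polynomial.eval_finsetSum, Finset.mul_sum,
      Finset.mul_sum]
    refine Finset.sum_congr rfl fun i _ => ?_
    rw [← Finset.mul_prod_erase _ _ (Finset.mem_univ i), Polynomial.eval_mul, Polynomial.eval_mul,
      hGeval]
    have h1 : (∑ j ∈ Finset.range (e i + 1), (Polynomial.X : Polynomial ℂ) ^ j).derivative.eval 1 =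
        ∑ j ∈ Finset.range (e i + 1), (j : ℂ) := by
      simp [Polynomial.eval_finsetSum, Polynomial.derivative_X_pow]
    have h2 : (∑ j ∈ Finset.range (e i + 1), (j : ℂ)) * 2 = (e i + 1) * e i := by
      have h3 := Finset.sum_range_id_mul_two (e i + 1)
      rw [Nat.add_sub_cancel] at h3
      have h4 := congrArg (Nat.cast : ℕ → ℂ) h3
      push_cast at h4
      exact h4
    rw [h1]
    linear_combination h2 * Polynomial.eval 1 (∏ j ∈ Finset.univ.erase i,
      ∑ k ∈ Finset.range (e j + 1), (Polynomial.X : Polynomial ℂ) ^ k)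
  have hT : hilbRing W * (((1 - Polynomial.X) ^ n * G : Polynomial ℂ) : PowerSeries ℂ) = 1 := by
    rw [← hf.hilbRing_mul fun i => Nat.succ_pos _]
    congr 1
    have : ((1 - Polynomial.X) ^ n * G : Polynomial ℂ) = ∏ i, (1 - Polynomial.X ^ (e i + 1)) := by
      have h0 : (1 - Polynomial.X : Polynomial ℂ) ^ n = ∏ _i : Fin n, (1 - Polynomial.X) := by
        rw [Finset.prod_const, Finset.card_univ, Fintype.card_fin]
      rw [hG, h0, ← Finset.prod_mul_distrib]
      exact Finset.prod_congr rfl fun i _ => mul_neg_geom_sum _ _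
    rw [this, ← Polynomial.coeToPowerSeries.ringHom_apply, map_prod]
    simp [Polynomial.coeToPowerSeries.ringHom_apply]
  -- Molien's formula `|W| / ∏ᵢ (1 - X ^ (e i + 1)) - ∑_w 1 / det (1 - X w⁻¹) = 0`, in which `none`
  -- indexes the first term.
  obtain ⟨h1, h2⟩ := expansion_at_one (ι := Option W) (n := n)
    (Q := fun o => o.elim (Polynomial.C (Nat.card W : ℂ)) fun _ => -1)
    (g := fun o => o.elim G fun w => unitPart fun i => (c w i)⁻¹)
    (k := fun o => o.elim n fun w => (Finset.univ.filter fun i => (c w i)⁻¹ = 1).card)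
    (T := fun o => o.elim (hilbRing W) fun w => geomProd fun i => (c w i)⁻¹)
    (by
      rintro (_ | w)
      exacts [le_rfl, card_eigenvalue_one_le fun i => (c w i)⁻¹])
    (by
      rintro (_ | w)
      exacts [hG0, eval_one_unitPart_ne_zero fun i => (c w i)⁻¹])
    (by
      rintro (_ | w)
      exacts [hT, geomProd_mul fun i => (c w i)⁻¹])
    (by
      rw [Fintype.sum_option]
      simp only [Option.elim_none, Option.elim_some, Polynomial.coe_C, Polynomial.coe_neg,
        Polynomial.coe_one, neg_mul, one_mul, Finset.sum_neg_distrib]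
      rw [molien_ring W b c h, add_neg_cancel])
  rw [Finset.sum_filter, Fintype.sum_option] at h1 h2
  rw [Finset.sum_filter, Fintype.sum_option] at h2
  simp only [Option.elim_none, Option.elim_some, if_true, Nat.succ_ne_self, if_false] at h1 h2
  replace h1 : (Polynomial.C (Nat.card W : ℂ)).eval 1 / G.eval 1 +
      ∑ w with (Finset.univ.filter fun i => (c w i)⁻¹ = 1).card = n,
        (-1 : Polynomial ℂ).eval 1 / (unitPart fun i => (c w i)⁻¹).eval 1 = 0 := by
    rw [Finset.sum_filter]; exact h1
  replace h2 : ((Polynomial.C (Nat.card W : ℂ)).derivative.eval 1 * G.eval 1 -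
        (Polynomial.C (Nat.card W : ℂ)).eval 1 * G.derivative.eval 1) / G.eval 1 ^ 2 +
      ∑ w with (Finset.univ.filter fun i => (c w i)⁻¹ = 1).card = n,
        ((-1 : Polynomial ℂ).derivative.eval 1 * (unitPart fun i => (c w i)⁻¹).eval 1 -
          (-1 : Polynomial ℂ).eval 1 * (unitPart fun i => (c w i)⁻¹).derivative.eval 1) /
            (unitPart fun i => (c w i)⁻¹).eval 1 ^ 2 =
      0 + ∑ w with (Finset.univ.filter fun i => (c w i)⁻¹ = 1).card + 1 = n,
        (-1 : Polynomial ℂ).eval 1 / (unitPart fun i => (c w i)⁻¹).eval 1 := by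
    rw [Finset.sum_filter, Finset.sum_filter]; exact h2
  rw [sum_filter_card_eq h, unitPart_one h] at h1
  rw [sum_filter_card_eq h, unitPart_one h, filter_card_add_one_eq h] at h2
  simp only [Polynomial.eval_C, Polynomial.eval_neg, Polynomial.eval_one, div_one] at h1
  have hcard : (Nat.card W : ℂ) = G.eval 1 := by
    rw [add_neg_eq_zero, div_eq_one_iff_eq hG0] at h1
    exact h1
  have h3 : ∑ w ∈ reflections W, Polynomial.eval 1 (-1 : Polynomial ℂ) /
      (unitPart fun i => (c w i)⁻¹).eval 1 =
      -∑ w ∈ reflections W, 1 / (1 - (detV (w : GLV n))⁻¹) := by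
    rw [← Finset.sum_neg_distrib]
    refine Finset.sum_congr rfl fun w hw => ?_
    rw [eval_unitPart_of_mem_reflections h hw, Polynomial.eval_neg, Polynomial.eval_one, neg_div]
  rw [h3, hcard] at h2
  simp only [Polynomial.derivative_C, Polynomial.eval_zero, Polynomial.eval_C,
    Polynomial.derivative_neg, Polynomial.derivative_one, neg_zero, zero_mul, zero_sub, mul_zero,
    Polynomial.eval_neg, sub_zero,
    zero_div, add_zero, zero_add] at h2
  have h4 := sum_reflections_inv_one_sub W
  have h5 : G.eval 1 * G.derivative.eval 1 / G.eval 1 ^ 2 = (∑ i, (e i : ℂ)) / 2 := by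
    field_simp
    linear_combination hG'
  rw [neg_div, neg_inj, h5] at h2
  rw [← h2] at h4
  have h6 : ∑ i, (e i : ℂ) = numReflections W := by rw [← h4]; ring
  exact_mod_cast h6

end DegreeSum

/-! ### Characters of `∧^k V* ⊗ ∧^r V` at reflections -/

lemma trace_exteriorPower_map {n : ℕ} {M : Type*} [AddCommGroup M] [Module ℂ M]
    (b : Module.Basis (Fin n) ℂ M) {T : M →ₗ[ℂ] M} {c : Fin n → ℂ} (h : ∀ i, T (b i) = c i • b i)
    (k : ℕ) : LinearMap.trace ℂ _ (exteriorPower.map k T) =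
      ∑ s ∈ (Finset.univ : Finset (Fin n)).powersetCard k, ∏ i ∈ s, c i := by
  rw [trace_eq_sum_of_apply_basis (b.exteriorPower k) _
    fun s => ∏ i ∈ (s : Finset (Fin n)), c i]
  · exact (Finset.sum_subtype _ (fun s => by simp) fun s : Finset (Fin n) => ∏ i ∈ s, c i).symm
  · intro s
    have himg : (s : Finset (Fin n)) =
        Finset.univ.image (Set.powersetCard.ofFinEmbEquiv.symm s) := by
      ext i
      refine (Set.powersetCard.mem_range_ofFinEmbEquiv_symm_iff_mem s i).symm.trans ?_
      rw [Finset.mem_image]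
      simp
    rw [exteriorPower.basis_apply, exteriorPower.map_apply_ιMulti_family, himg,
      Finset.prod_image fun _ _ _ _ h' => (Set.powersetCard.ofFinEmbEquiv.symm s).injective h']
    have h1 := (exteriorPower.ιMulti ℂ k (M := M)).toMultilinearMap.map_smul_univ
      (fun j => c (Set.powersetCard.ofFinEmbEquiv.symm s j))
      (fun j => b (Set.powersetCard.ofFinEmbEquiv.symm s j))
    refine Eq.trans ?_ h1
    refine congrArg (exteriorPower.ιMulti ℂ k (M := M)) (funext fun j => ?_)
    exact h _

/-- The `k`-th elementary symmetric function of a family with at most one entry different from `1`. -/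
lemma sum_powersetCard_prod_eq {n : ℕ} {c : Fin n → ℂ} {i₀ : Fin n} (h : ∀ i, i ≠ i₀ → c i = 1)
    (k : ℕ) : ∑ s ∈ (Finset.univ : Finset (Fin n)).powersetCard k, ∏ i ∈ s, c i =
      (n - 1).choose k + c i₀ * choosePred (n - 1) k := by
  have hcard : (Finset.univ.erase i₀).card = n - 1 := by
    rw [Finset.card_erase_of_mem (Finset.mem_univ _), Finset.card_univ, Fintype.card_fin]
  have hone : ∀ s ⊆ Finset.univ.erase i₀, ∏ i ∈ s, c i = 1 := fun s hs =>
    Finset.prod_eq_one fun i hi => h i (Finset.ne_of_mem_erase (hs hi))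
  cases k with
  | zero => simp [choosePred]
  | succ k =>
    have hdisj : Disjoint ((Finset.univ.erase i₀).powersetCard (k + 1))
        (((Finset.univ.erase i₀).powersetCard k).image (insert i₀)) := by
      refine Finset.disjoint_left.2 fun s hs hs' => ?_
      obtain ⟨t, -, rfl⟩ := Finset.mem_image.1 hs'
      exact Finset.notMem_erase i₀ _ ((Finset.mem_powersetCard.1 hs).1 (Finset.mem_insert_self _ _))
    have hnot : ∀ t ∈ (Finset.univ.erase i₀).powersetCard k, i₀ ∉ t := fun t ht hmem =>
      Finset.notMem_erase i₀ _ ((Finset.mem_powersetCard.1 ht).1 hmem)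
    rw [← Finset.insert_erase (Finset.mem_univ i₀),
      Finset.powersetCard_succ_insert (Finset.notMem_erase _ _), Finset.sum_union hdisj,
      Finset.sum_image]
    · congr 1
      · rw [Finset.sum_congr rfl fun s hs => hone s (Finset.mem_powersetCard.1 hs).1,
          Finset.sum_const, Finset.card_powersetCard, hcard, nsmul_eq_mul, mul_one]
      · rw [Finset.sum_congr rfl fun t ht => (Finset.prod_insert (hnot t ht)).trans
          (congrArg (c i₀ * ·) (hone t (Finset.mem_powersetCard.1 ht).1)),
          Finset.sum_const, Finset.card_powersetCard, hcard, nsmul_eq_mul, mul_one, mul_comm,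
          choosePred, if_neg (Nat.succ_ne_zero k), Nat.add_sub_cancel]
    · intro s hs t ht hst
      rw [← Finset.erase_insert (hnot s hs), hst, Finset.erase_insert (hnot t ht)]

lemma trace_extPow_stdRep {n : ℕ} {W : Subgroup (GLV n)} [Finite W] {w : W}
    (hw : IsReflection (w : GLV n)) (r : ℕ) :
    LinearMap.trace ℂ _ (extPow (stdRep W) r w) =
      (n - 1).choose r + detV (w : GLV n) * choosePred (n - 1) r := by
  obtain ⟨b, c, h⟩ := exists_eigenbasis w.2
  obtain ⟨i₀, -, h2, h3⟩ := hw.exists_index h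
  rw [← h2, ← sum_powersetCard_prod_eq h3]
  exact trace_exteriorPower_map b h r

lemma trace_extPow_dual {n : ℕ} {W : Subgroup (GLV n)} [Finite W] {w : W}
    (hw : IsReflection (w : GLV n)) (k : ℕ) :
    LinearMap.trace ℂ _ (extPow (stdRep W).dual k w) =
      (n - 1).choose k + (detV (w : GLV n))⁻¹ * choosePred (n - 1) k := by
  obtain ⟨b, c, h⟩ := exists_eigenbasis (inv_mem w.2)
  obtain ⟨i₀, -, h2, h3⟩ := (isReflection_inv hw).exists_index h
  rw [← detV_inv, ← h2, ← sum_powersetCard_prod_eq h3]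
  refine trace_exteriorPower_map b.dualBasis (fun i => b.ext fun j => ?_) k
  change b.dualBasis i ((((w : GLV n)⁻¹ : GLV n) : Module.End ℂ (V n)) (b j)) =
    (c i • b.dualBasis i) (b j)
  rw [LinearMap.smul_apply, b.dualBasis_apply_self]
  refine (congrArg (b.dualBasis i) (h j)).trans ?_
  rw [map_smul, b.dualBasis_apply_self]
  split_ifs with hij
  · rw [hij]
  · rw [smul_zero, smul_zero]

lemma choose_eq_choose_add_choosePred {n : ℕ} (hn : 0 < n) (k : ℕ) :
    n.choose k = (n - 1).choose k + choosePred (n - 1) k := by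
  obtain ⟨m, rfl⟩ : ∃ m, n = m + 1 := ⟨n - 1, by omega⟩
  cases k with
  | zero => simp [choosePred]
  | succ k => rw [Nat.choose_succ_succ, choosePred, if_neg (Nat.succ_ne_zero k), add_comm]; rfl

/-- The degree sum of a homogeneous basis of `(S(V*) ⊗ ∧^k V* ⊗ ∧^r V)^W`. -/
lemma sum_degrees_mixedRep {n : ℕ} {W : Subgroup (GLV n)} [Fintype W] {k r m : ℕ}
    {β : Fin m → S n ⊗[ℂ] ((⋀[ℂ]^k (Module.Dual ℂ (V n))) ⊗[ℂ] (⋀[ℂ]^r (V n)))} {d : Fin m → ℕ}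
    (hβ : IsHomogeneousBasis W (mixedRep W k r) β d) :
    ∑ i, d i = choosePred (n - 1) k * (n - 1).choose r * numReflections W +
      (n - 1).choose k * choosePred (n - 1) r * numHyperplanes W := by
  have h1 := (IsHomogeneousBasis.card_and_sum_degrees
    (U := (⋀[ℂ]^k (Module.Dual ℂ (V n))) ⊗[ℂ] (⋀[ℂ]^r (V n))) hβ).2
  have h2 : ∀ w ∈ reflections W,
      ((Module.finrank ℂ ((⋀[ℂ]^k (Module.Dual ℂ (V n))) ⊗[ℂ] (⋀[ℂ]^r (V n))) : ℂ) -
        LinearMap.trace ℂ _ (mixedRep W k r w)) / (1 - (detV (w : GLV n))⁻¹) =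
      choosePred (n - 1) k * (n - 1).choose r -
        (n - 1).choose k * choosePred (n - 1) r * detV (w : GLV n) := by
    intro w hw
    have hr := mem_reflections.1 hw
    have hn : 0 < n := by
      have : Module.finrank ℂ (fixedSpace (w : GLV n)) + 1 = n := hr
      omega
    have htr : LinearMap.trace ℂ _ (mixedRep W k r w) =
        LinearMap.trace ℂ _ (extPow (stdRep W).dual k w) *
          LinearMap.trace ℂ _ (extPow (stdRep W) r w) :=
      LinearMap.trace_tensorProduct' (R := ℂ) _ _
    rw [htr, trace_extPow_stdRep hr, trace_extPow_dual hr, Module.finrank_tensorProduct,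
      exteriorPower.finrank_eq, exteriorPower.finrank_eq, Subspace.dual_finrank_eq,
      Module.finrank_fin_fun, choose_eq_choose_add_choosePred hn k,
      choose_eq_choose_add_choosePred hn r]
    have h0 := detV_ne_zero (w : GLV n)
    have h3 := sub_ne_zero.2 (hr.detV_ne_one w.2)
    have h5 : 1 - (detV (w : GLV n))⁻¹ = (detV (w : GLV n) - 1) / detV (w : GLV n) := by
      field_simp
    rw [h5, div_div_eq_mul_div, div_eq_iff h3]
    push_cast
    field_simp
    ring
  rw [Finset.sum_congr rfl h2, Finset.sum_sub_distrib, Finset.sum_const, card_reflections,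
    ← Finset.mul_sum, sum_reflections_detV, nsmul_eq_mul] at h1
  have h3 : (∑ i, d i : ℂ) = ((choosePred (n - 1) k * (n - 1).choose r * numReflections W +
      (n - 1).choose k * choosePred (n - 1) r * numHyperplanes W : ℕ) : ℂ) := by
    rw [h1]; push_cast; ring
  exact_mod_cast h3

/-- The coexponents add up to the number of reflecting hyperplanes. -/
lemma sum_coexponents {n : ℕ} {W : Subgroup (GLV n)} [Fintype W] {c : Fin n → ℕ}
    (hc : IsCoexponents W c) : ∑ i, c i = numHyperplanes W := by
  obtain ⟨-, θ, hθ⟩ := hc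
  have h1 := hθ.card_and_sum_degrees.2
  have h2 : ∀ w ∈ reflections W, ((Module.finrank ℂ (V n) : ℂ) -
      LinearMap.trace ℂ _ (stdRep W w)) / (1 - (detV (w : GLV n))⁻¹) = -detV (w : GLV n) := by
    intro w hw
    have hr := mem_reflections.1 hw
    obtain ⟨b, c, h⟩ := exists_eigenbasis w.2
    obtain ⟨i₀, -, hi₀, hc⟩ := hr.exists_index h
    have htr : LinearMap.trace ℂ _ (stdRep W w) = ∑ i, c i := trace_eq_sum_of_apply_basis b _ c h
    have hsum : (n : ℂ) - ∑ i, c i = 1 - detV (w : GLV n) := by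
      have : (n : ℂ) = ∑ _i : Fin n, 1 := by simp
      rw [this, ← Finset.sum_sub_distrib, Finset.sum_eq_single i₀, hi₀]
      · intro i _ hi; rw [hc i hi, sub_self]
      · exact fun h' => (h' (Finset.mem_univ _)).elim
    rw [Module.finrank_fin_fun, htr, hsum]
    have h0 := detV_ne_zero (w : GLV n)
    have h3 := sub_ne_zero.2 (hr.detV_ne_one w.2)
    have h5 : 1 - (detV (w : GLV n))⁻¹ = (detV (w : GLV n) - 1) / detV (w : GLV n) := by
      field_simp
    rw [h5, div_div_eq_mul_div, div_eq_iff h3]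
    ring
  rw [Finset.sum_congr rfl h2, Finset.sum_neg_distrib, sum_reflections_detV, neg_neg] at h1
  exact_mod_cast h1

/-- `(S(V*) ⊗ ∧^k V* ⊗ ∧^r V)^W` is free over `S(V*)^W`, and the degrees of every homogeneous basis
add up to the character sum over the reflections. -/
lemma sumOfUExponentsIs_mixedRep {n : ℕ} {W : Subgroup (GLV n)} (hW : IsReflectionGroup W)
    (k r : ℕ) :
    SumOfUExponentsIs W (mixedRep W k r)
      (choosePred (n - 1) k * (n - 1).choose r * numReflections W +
        (n - 1).choose k * choosePred (n - 1) r * numHyperplanes W) := by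
  have := hW.1
  have := Fintype.ofFinite W
  refine ⟨?_, fun m b d hb => sum_degrees_mixedRep hb⟩
  obtain ⟨m, d, hd⟩ := exists_isUExponents
    (U := (⋀[ℂ]^k (Module.Dual ℂ (V n))) ⊗[ℂ] (⋀[ℂ]^r (V n))) hW
    (mixedRep W k r)
  obtain ⟨b, hb⟩ := hd.2
  obtain rfl := (IsHomogeneousBasis.card_and_sum_degrees
    (U := (⋀[ℂ]^k (Module.Dual ℂ (V n))) ⊗[ℂ] (⋀[ℂ]^r (V n))) hb).1
  exact ⟨d, hd⟩

/-! ### Degrees of the elements `df_L · θ̃_I (θ_J)` -/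

/-- The homogeneous polynomials of degree `δ ∈ ℤ`; only the zero polynomial when `δ < 0`. -/
def homogeneousInt (n : ℕ) (δ : ℤ) : Submodule ℂ (S n) :=
  if 0 ≤ δ then MvPolynomial.homogeneousSubmodule (Fin n) ℂ δ.toNat else ⊥

lemma mem_homogeneousInt_natCast {n m : ℕ} {f : S n} :
    f ∈ homogeneousInt n m ↔ f.IsHomogeneous m := by
  simp [homogeneousInt]

lemma mem_homogeneousInt_iff {n : ℕ} {δ : ℤ} {f : S n} :
    f ∈ homogeneousInt n δ ↔ f = 0 ∨ ∃ m : ℕ, (m : ℤ) = δ ∧ f.IsHomogeneous m := by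
  constructor
  · intro hf
    rcases lt_or_ge δ 0 with h | h
    · rw [homogeneousInt, if_neg (not_le.2 h)] at hf
      exact Or.inl hf
    · lift δ to ℕ using h
      exact Or.inr ⟨δ, rfl, mem_homogeneousInt_natCast.1 hf⟩
  · rintro (rfl | ⟨m, rfl, hf⟩)
    · exact zero_mem _
    · exact mem_homogeneousInt_natCast.2 hf

lemma mul_mem_homogeneousInt {n : ℕ} {δ ε : ℤ} {f g : S n} (hf : f ∈ homogeneousInt n δ)
    (hg : g ∈ homogeneousInt n ε) : f * g ∈ homogeneousInt n (δ + ε) := by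
  rw [mem_homogeneousInt_iff] at hf hg ⊢
  rcases hf with rfl | ⟨m, rfl, hf⟩
  · exact Or.inl (zero_mul _)
  · rcases hg with rfl | ⟨m', rfl, hg⟩
    · exact Or.inl (mul_zero _)
    · exact Or.inr ⟨m + m', by push_cast; rfl, hf.mul hg⟩

lemma pderiv_mem_homogeneousInt {n : ℕ} {δ : ℤ} {f : S n} (hf : f ∈ homogeneousInt n δ)
    (i : Fin n) : MvPolynomial.pderiv i f ∈ homogeneousInt n (δ - 1) := by
  rw [mem_homogeneousInt_iff] at hf ⊢
  rcases hf with rfl | ⟨m, rfl, hf⟩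
  · exact Or.inl (map_zero _)
  · cases m with
    | zero =>
      left
      obtain ⟨c, rfl⟩ : ∃ c, f = MvPolynomial.C c :=
        ⟨_, (MvPolynomial.totalDegree_eq_zero_iff_eq_C.1 (Nat.le_zero.1 hf.totalDegree_le))⟩
      exact MvPolynomial.pderiv_C
    | succ m => exact Or.inr ⟨m, by push_cast; ring, by simpa using hf.pderiv (i := i)⟩

lemma monomialDeriv_mem_homogeneousInt {n : ℕ} (a : Fin n →₀ ℕ) {δ : ℤ} {f : S n}
    (hf : f ∈ homogeneousInt n δ) : monomialDeriv a f ∈ homogeneousInt n (δ - a.degree) := by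
  have hpow : ∀ (i : Fin n) (p : ℕ) {δ : ℤ} {f : S n}, f ∈ homogeneousInt n δ →
      (((MvPolynomial.pderiv i).toLinearMap : Module.End ℂ (S n)) ^ p) f ∈
        homogeneousInt n (δ - p) := by
    intro i p
    induction p with
    | zero => intro δ f hf; simpa using hf
    | succ p ih =>
      intro δ f hf
      rw [pow_succ, Module.End.mul_apply, Nat.cast_succ, add_comm (p : ℤ), ← sub_sub]
      exact ih (pderiv_mem_homogeneousInt hf i)
  have hlist : ∀ l : List (Fin n), (l.map fun i =>
      ((MvPolynomial.pderiv i).toLinearMap : Module.End ℂ (S n)) ^ a i).prod f ∈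
        homogeneousInt n (δ - (l.map a).sum) := by
    intro l
    induction l with
    | nil => simpa using hf
    | cons i l ih =>
      simp only [List.map_cons, List.prod_cons, List.sum_cons, Module.End.mul_apply]
      rw [Nat.cast_add, add_comm (a i : ℤ), ← sub_sub]
      exact hpow i _ ih
  have h := hlist (List.finRange n)
  rwa [← List.ofFn_eq_map, List.sum_ofFn, ← Finsupp.degree_eq_sum] at h

lemma conjDiffOp_mem_homogeneousInt {n d : ℕ} {h : S n} (hh : h.IsHomogeneous d) {δ : ℤ} {f : S n}
    (hf : f ∈ homogeneousInt n δ) : conjDiffOp h f ∈ homogeneousInt n (δ - d) := by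
  rw [conjDiffOp, LinearMap.sum_apply]
  refine Submodule.sum_mem _ fun a ha => Submodule.smul_mem _ _ ?_
  have hd : a.degree = d := by
    rw [← hh (MvPolynomial.mem_support_iff.1 ha), Finsupp.degree_eq_weight_one]
    rfl
  rw [← hd]
  exact monomialDeriv_mem_homogeneousInt a hf

/-- `S^δ(V*) ⊗ ∧^k V* ⊗ ∧^r V` for an integral degree `δ`. -/
def omegaInt (n : ℕ) (δ : ℤ) (k r : ℕ) : Submodule ℂ (Omega n) :=
  LinearMap.range (TensorProduct.map (homogeneousInt n δ).subtype
    (TensorProduct.map (⋀[ℂ]^k (Module.Dual ℂ (V n))).subtype (⋀[ℂ]^r (V n)).subtype))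

lemma tmul_mem_omegaInt {n k r : ℕ} {δ : ℤ} {f : S n}
    {a : ExteriorAlgebra ℂ (Module.Dual ℂ (V n))} {b : ExteriorAlgebra ℂ (V n)}
    (hf : f ∈ homogeneousInt n δ) (ha : a ∈ ⋀[ℂ]^k (Module.Dual ℂ (V n))) (hb : b ∈ ⋀[ℂ]^r (V n)) :
    f ⊗ₜ[ℂ] (a ⊗ₜ[ℂ] b) ∈ omegaInt n δ k r :=
  ⟨⟨f, hf⟩ ⊗ₜ[ℂ] ((⟨a, ha⟩ : ⋀[ℂ]^k (Module.Dual ℂ (V n))) ⊗ₜ[ℂ] (⟨b, hb⟩ : ⋀[ℂ]^r (V n))), rfl⟩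

lemma omegaInt_le {n k r : ℕ} {δ : ℤ} {P : Submodule ℂ (Omega n)}
    (h : ∀ f ∈ homogeneousInt n δ, ∀ a ∈ ⋀[ℂ]^k (Module.Dual ℂ (V n)), ∀ b ∈ ⋀[ℂ]^r (V n),
      f ⊗ₜ[ℂ] (a ⊗ₜ[ℂ] b) ∈ P) : omegaInt n δ k r ≤ P := by
  rintro _ ⟨t, rfl⟩
  induction t using TensorProduct.induction_on with
  | zero => rw [map_zero]; exact zero_mem _
  | add x y hx hy => rw [map_add]; exact add_mem hx hy
  | tmul f u =>
    induction u using TensorProduct.induction_on with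
    | zero => rw [TensorProduct.tmul_zero, map_zero]; exact zero_mem _
    | add x y hx hy => rw [TensorProduct.tmul_add, map_add]; exact add_mem hx hy
    | tmul a b => exact h _ f.2 _ a.2 _ b.2

lemma isHomogeneousOmega_of_mem {n k r : ℕ} {δ : ℤ} {ω : Omega n} (h : ω ∈ omegaInt n δ k r) :
    IsHomogeneousOmega k r δ ω := by
  rcases lt_or_ge δ 0 with hδ | hδ
  · left
    refine (Submodule.mem_bot ℂ).1 (omegaInt_le (fun f hf a _ b _ => ?_) h)
    rw [homogeneousInt, if_neg (not_le.2 hδ), Submodule.mem_bot] at hf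
    rw [hf, TensorProduct.zero_tmul]
    exact zero_mem _
  · lift δ to ℕ using hδ
    refine Or.inr ⟨δ, rfl, omegaInt_le (fun f hf a ha b hb => ?_) h⟩
    exact ⟨⟨f, mem_homogeneousInt_natCast.1 hf⟩ ⊗ₜ[ℂ]
      ((⟨a, ha⟩ : ⋀[ℂ]^k (Module.Dual ℂ (V n))) ⊗ₜ[ℂ] (⟨b, hb⟩ : ⋀[ℂ]^r (V n))), rfl⟩

lemma mul_mem_exteriorPower {M : Type*} [AddCommGroup M] [Module ℂ M] {k l : ℕ}
    {x y : ExteriorAlgebra ℂ M} (hx : x ∈ ⋀[ℂ]^k M) (hy : y ∈ ⋀[ℂ]^l M) :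
    x * y ∈ ⋀[ℂ]^(k + l) M := by
  rw [ExteriorAlgebra.exteriorPower, pow_add]
  exact Submodule.mul_mem_mul hx hy

lemma ι_mem_exteriorPower_one {M : Type*} [AddCommGroup M] [Module ℂ M] (x : M) :
    ExteriorAlgebra.ι ℂ x ∈ ⋀[ℂ]^1 M := by
  rw [ExteriorAlgebra.exteriorPower, pow_one]
  exact ⟨x, rfl⟩

lemma one_mem_exteriorPower_zero {M : Type*} [AddCommGroup M] [Module ℂ M] :
    (1 : ExteriorAlgebra ℂ M) ∈ ⋀[ℂ]^0 M := by
  rw [ExteriorAlgebra.exteriorPower, pow_zero]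
  exact Submodule.one_le.1 le_rfl

lemma mul_mem_omegaInt {n k r k' r' : ℕ} {δ ε : ℤ} {x y : Omega n} (hx : x ∈ omegaInt n δ k r)
    (hy : y ∈ omegaInt n ε k' r') : x * y ∈ omegaInt n (δ + ε) (k + k') (r + r') := by
  refine omegaInt_le (P := (omegaInt n (δ + ε) (k + k') (r + r')).comap
    (LinearMap.mulRight ℂ y)) (fun f hf a ha b hb => ?_) hx
  refine omegaInt_le (P := (omegaInt n (δ + ε) (k + k') (r + r')).comap
    (LinearMap.mulLeft ℂ (f ⊗ₜ[ℂ] (a ⊗ₜ[ℂ] b)))) (fun f' hf' a' ha' b' hb' => ?_) hy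
  change (f ⊗ₜ[ℂ] (a ⊗ₜ[ℂ] b)) * (f' ⊗ₜ[ℂ] (a' ⊗ₜ[ℂ] b')) ∈ omegaInt n (δ + ε) (k + k') (r + r')
  rw [Algebra.TensorProduct.tmul_mul_tmul, Algebra.TensorProduct.tmul_mul_tmul]
  exact tmul_mem_omegaInt (mul_mem_homogeneousInt hf hf') (mul_mem_exteriorPower ha ha')
    (mul_mem_exteriorPower hb hb')

lemma one_mem_omegaInt {n : ℕ} : (1 : Omega n) ∈ omegaInt n 0 0 0 :=
  tmul_mem_omegaInt (mem_homogeneousInt_natCast.2 (MvPolynomial.isHomogeneous_one _ _))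
    one_mem_exteriorPower_zero one_mem_exteriorPower_zero

lemma diff_mem_omegaInt {n e : ℕ} {f : S n} (hf : f.IsHomogeneous (e + 1)) :
    diff f ∈ omegaInt n e 1 0 := by
  refine Submodule.sum_mem _ fun i _ => tmul_mem_omegaInt ?_ (ι_mem_exteriorPower_one _)
    one_mem_exteriorPower_zero
  have h := pderiv_mem_homogeneousInt (mem_homogeneousInt_natCast.2 hf) i
  rwa [Nat.cast_succ, add_sub_cancel_right] at h

lemma derToOmega_mem_omegaInt {n d : ℕ} {θ : S n ⊗[ℂ] V n} (hθ : θ ∈ tensorPiece n (V n) d) :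
    derToOmega θ ∈ omegaInt n d 0 1 := by
  obtain ⟨t, rfl⟩ := hθ
  induction t using TensorProduct.induction_on with
  | zero => rw [map_zero, map_zero]; exact zero_mem _
  | add x y hx hy => rw [map_add, map_add]; exact add_mem hx hy
  | tmul f v =>
    exact tmul_mem_omegaInt (mem_homogeneousInt_natCast.2 f.2) one_mem_exteriorPower_zero
      (ι_mem_exteriorPower_one v)

lemma isHomogeneous_derCoeff {n d : ℕ} {θ : S n ⊗[ℂ] V n} (hθ : θ ∈ tensorPiece n (V n) d)
    (j : Fin n) : (derCoeff θ j).IsHomogeneous d := by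
  rw [← MvPolynomial.mem_homogeneousSubmodule]
  obtain ⟨t, rfl⟩ := hθ
  induction t using TensorProduct.induction_on with
  | zero => simp only [derCoeff, map_zero]; exact zero_mem _
  | add x y hx hy =>
    simp only [derCoeff, map_add] at hx hy ⊢
    exact add_mem hx hy
  | tmul f v =>
    have h : derCoeff ((MvPolynomial.homogeneousSubmodule (Fin n) ℂ d).subtype.rTensor (V n)
        (f ⊗ₜ[ℂ] v)) j = v j • (f : S n) := by
      simp [derCoeff]
    rw [h]
    exact Submodule.smul_mem _ _ f.2

lemma tildeOp_mem_omegaInt {n d k r : ℕ} {θ : S n ⊗[ℂ] V n} (hθ : θ ∈ tensorPiece n (V n) d)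
    {δ : ℤ} {ω : Omega n} (hω : ω ∈ omegaInt n δ k r) :
    tildeOp θ ω ∈ omegaInt n (δ - d) (k + 1) r := by
  refine omegaInt_le (P := (omegaInt n (δ - d) (k + 1) r).comap (tildeOp θ))
    (fun f hf a ha b hb => ?_) hω
  rw [Submodule.mem_comap, tildeOp, LinearMap.sum_apply]
  refine Submodule.sum_mem _ fun j _ => ?_
  rw [TensorProduct.map_tmul, TensorProduct.map_tmul]
  refine tmul_mem_omegaInt (conjDiffOp_mem_homogeneousInt (isHomogeneous_derCoeff hθ j) hf) ?_ hb
  rw [add_comm k]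
  exact mul_mem_exteriorPower (ι_mem_exteriorPower_one _) ha

lemma sum_map_sort {α M : Type*} [LinearOrder α] [AddCommMonoid M] (s : Finset α) (g : α → M) :
    (s.sort.map g).sum = ∑ i ∈ s, g i := by
  rw [Finset.sum, ← Finset.sort_eq s (· ≤ ·), Multiset.map_coe, Multiset.sum_coe]

/-- `df_L · θ̃_I (θ_J)` lies in the component of degree
`(∑_{l ∈ L} e_l + ∑_{j ∈ J} e*_j - ∑_{i ∈ I} e*_i, |I| + |L|, |J|)`. -/
lemma isHomogeneousOmega_basisElement {n : ℕ} {e c : Fin n → ℕ} {f : Fin n → S n}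
    {θ : Fin n → S n ⊗[ℂ] V n} (hf : ∀ i, (f i).IsHomogeneous (e i + 1))
    (hθ : ∀ i, θ i ∈ tensorPiece n (V n) (c i)) (I J L : Finset (Fin n)) :
    IsHomogeneousOmega (I.card + L.card) J.card (basisDegree e c I J L)
      (basisElement f θ I J L) := by
  have hdf : ∀ l : List (Fin n), (l.map fun i => diff (f i)).prod ∈
      omegaInt n (l.map fun i => (e i : ℤ)).sum l.length 0 := by
    intro l
    induction l with
    | nil => exact one_mem_omegaInt
    | cons i l ih =>
      simp only [List.map_cons, List.prod_cons, List.sum_cons, List.length_cons]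
      rw [add_comm l.length]
      have h := mul_mem_omegaInt (diff_mem_omegaInt (hf i)) ih
      rwa [add_zero] at h
  have hder : ∀ l : List (Fin n), (l.map fun i => derToOmega (θ i)).prod ∈
      omegaInt n (l.map fun i => (c i : ℤ)).sum 0 l.length := by
    intro l
    induction l with
    | nil => exact one_mem_omegaInt
    | cons i l ih =>
      simp only [List.map_cons, List.prod_cons, List.sum_cons, List.length_cons]
      rw [add_comm l.length]
      have h := mul_mem_omegaInt (derToOmega_mem_omegaInt (hθ i)) ih
      rwa [add_zero] at h
  have htilde : ∀ (l : List (Fin n)) {δ : ℤ} {k r : ℕ} {ω : Omega n}, ω ∈ omegaInt n δ k r →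
      (l.map fun i => tildeOp (θ i)).prod ω ∈
        omegaInt n (δ - (l.map fun i => (c i : ℤ)).sum) (k + l.length) r := by
    intro l δ k r ω hω
    induction l with
    | nil => simpa using hω
    | cons i l ih =>
      simp only [List.map_cons, List.prod_cons, List.sum_cons, List.length_cons,
        Module.End.mul_apply]
      rw [← add_assoc, add_comm (c i : ℤ), ← sub_sub]
      exact tildeOp_mem_omegaInt (hθ i) ih
  have h := mul_mem_omegaInt (hdf L.sort) (htilde I.sort (hder J.sort))
  rw [sum_map_sort, sum_map_sort, sum_map_sort, Finset.length_sort, Finset.length_sort,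
    Finset.length_sort, zero_add, zero_add, add_comm L.card, ← add_sub_assoc] at h
  exact isHomogeneousOmega_of_mem h

/-! ### The degree sum over the triples `(I, J, L)` -/

lemma sum_powersetCard_sum {α M : Type*} [DecidableEq α] [CommSemiring M] (s : Finset α) (k : ℕ)
    (w : α → M) : ∑ K ∈ s.powersetCard k, ∑ x ∈ K, w x =
      choosePred (s.card - 1) k * ∑ x ∈ s, w x := by
  have hcard : ∀ x ∈ s, ((s.powersetCard k).filter (x ∈ ·)).card = choosePred (s.card - 1) k := by
    intro x hx
    cases k with
    | zero => simp [choosePred]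
    | succ k =>
      rw [choosePred, if_neg (Nat.succ_ne_zero k)]
      simpa using Finset.card_filter_powersetCard_subset {x} s (k + 1)
        (Finset.singleton_subset_iff.2 hx) (by simp)
  calc ∑ K ∈ s.powersetCard k, ∑ x ∈ K, w x
      = ∑ K ∈ s.powersetCard k, ∑ x ∈ s, if x ∈ K then w x else 0 := by
        refine Finset.sum_congr rfl fun K hK => ?_
        rw [← Finset.sum_filter, Finset.filter_mem_eq_inter,
          Finset.inter_eq_right.2 (Finset.mem_powersetCard.1 hK).1]
    _ = ∑ x ∈ s, choosePred (s.card - 1) k * w x := by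
        rw [Finset.sum_comm]
        refine Finset.sum_congr rfl fun x hx => ?_
        rw [← Finset.sum_filter, Finset.sum_const, hcard x hx, nsmul_eq_mul]
    _ = _ := by rw [Finset.mul_sum]

lemma card_firstIdx {n r : ℕ} (hr : r ≤ n) : (firstIdx n r).card = r := by
  rw [firstIdx, Fin.card_filter_val_lt, min_eq_right hr]

/-- A pair `(I, L)` with `I ⊆ [r]`, `L ⊆ [n-r]` and `|I| + |L| = k` is a `k`-subset of the disjoint
union of `[r]` and `[n-r]`. -/
lemma sum_basisIndex {n k r : ℕ} {M : Type*} [AddCommMonoid M]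
    (g : Finset (Fin n) → Finset (Fin n) → Finset (Fin n) → M) :
    ∑ T ∈ basisIndex n k r, g T.1 T.2.1 T.2.2 =
      ∑ J ∈ (Finset.univ : Finset (Fin n)).powersetCard r,
        ∑ K ∈ ((firstIdx n r).disjSum (firstIdx n (n - r))).powersetCard k,
          g K.toLeft J K.toRight := by
  rw [← Finset.sum_product']
  refine Finset.sum_nbij' (fun T => (T.2.1, T.1.disjSum T.2.2))
    (fun P => (P.2.toLeft, P.1, P.2.toRight)) ?_ ?_ ?_ ?_ ?_
  · rintro ⟨I, J, L⟩ hT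
    simp only [basisIndex, Finset.mem_filter, Finset.mem_univ, true_and] at hT
    simp only [Finset.mem_product, Finset.mem_powersetCard, Finset.subset_univ, true_and,
      Finset.card_disjSum]
    exact ⟨hT.2.2.1, Finset.disjSum_mono hT.1 hT.2.1, hT.2.2.2⟩
  · rintro ⟨J, K⟩ hP
    simp only [Finset.mem_product, Finset.mem_powersetCard, Finset.subset_univ, true_and] at hP
    simp only [basisIndex, Finset.mem_filter, Finset.mem_univ, true_and]
    have h1 := Finset.toLeft_subset_toLeft hP.2.1
    have h2 := Finset.toRight_subset_toRight hP.2.1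
    rw [Finset.toLeft_disjSum] at h1
    rw [Finset.toRight_disjSum] at h2
    exact ⟨h1, h2, hP.1, by rw [Finset.card_toLeft_add_card_toRight, hP.2.2]⟩
  · rintro ⟨I, J, L⟩ -
    simp
  · rintro ⟨J, K⟩ -
    simp [Finset.toLeft_disjSum_toRight]
  · rintro ⟨I, J, L⟩ -
    simp

/-- By duality the `e*_i` with `i ≤ r` are `h` minus the last `r` exponents, so that the elements of the
disjoint union of `[r]` and `[n-r]`, weighted by `-e*_i` and `e_i`, have total weight
`∑ e_i - r h`. -/
lemma sum_exponents_sub_sum_coexponents {n h r : ℕ} (hr : r ≤ n) {e c : Fin n → ℕ}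
    (hdual : ∀ i, e i + c i.rev = h) :
    ∑ i ∈ firstIdx n (n - r), (e i : ℤ) - ∑ i ∈ firstIdx n r, (c i : ℤ) =
      ∑ i, (e i : ℤ) - r * h := by
  have h1 : ∑ i ∈ firstIdx n r, (c i : ℤ) = r * h - ∑ i ∈ firstIdx n r, (e i.rev : ℤ) := by
    rw [eq_sub_iff_add_eq, ← Finset.sum_add_distrib, Finset.sum_congr rfl (g := fun _ => (h : ℤ)),
      Finset.sum_const, card_firstIdx hr, nsmul_eq_mul]
    intro i _
    have := hdual i.rev
    rw [Fin.rev_rev] at this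
    rw [← this]
    push_cast
    ring
  have h2 : ∑ i ∈ firstIdx n r, (e i.rev : ℤ) =
      ∑ i ∈ Finset.univ.filter (fun i : Fin n => ¬ (i : ℕ) < n - r), (e i : ℤ) := by
    refine Finset.sum_nbij' Fin.rev Fin.rev ?_ ?_ ?_ ?_ ?_
    · intro i hi
      simp only [firstIdx, Finset.mem_filter, Finset.mem_univ, true_and, Fin.val_rev] at hi ⊢
      omega
    · intro i hi
      have := i.2
      simp only [firstIdx, Finset.mem_filter, Finset.mem_univ, true_and, Fin.val_rev] at hi ⊢
      omega
    · exact fun i _ => Fin.rev_rev i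
    · exact fun i _ => Fin.rev_rev i
    · exact fun i _ => rfl
  have h3 := Finset.sum_filter_add_sum_filter_not (Finset.univ : Finset (Fin n))
    (fun i => (i : ℕ) < n - r) (fun i => (e i : ℤ))
  rw [h1, h2, ← h3, firstIdx]
  ring

lemma mul_choose_eq_mul_choosePred {n : ℕ} (hn : 0 < n) (r : ℕ) :
    r * n.choose r = n * choosePred (n - 1) r := by
  obtain ⟨m, rfl⟩ : ∃ m, n = m + 1 := ⟨n - 1, by omega⟩
  cases r with
  | zero => simp [choosePred]
  | succ r =>
    rw [choosePred, if_neg (Nat.succ_ne_zero r), Nat.add_sub_cancel, Nat.add_sub_cancel,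
      Nat.add_one_mul_choose_eq, mul_comm]

/-- For a duality pattern `e_i + e*_{n+1-i} = h`, the degrees of the elements `df_L · θ̃_I (θ_J)` add
up to the same expression in `∑ e_i` and `∑ e*_i` as the exponents of `∧^k V* ⊗ ∧^r V`. -/
lemma sum_basisDegree {n h k r N N' : ℕ} (hr : r ≤ n) {e c : Fin n → ℕ}
    (hdual : ∀ i, e i + c i.rev = h) (he : ∑ i, e i = N) (hc : ∑ i, c i = N') :
    ∑ T ∈ basisIndex n k r, basisDegree e c T.1 T.2.1 T.2.2 =
      ((choosePred (n - 1) k * (n - 1).choose r * N +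
        (n - 1).choose k * choosePred (n - 1) r * N' : ℕ) : ℤ) := by
  have hN : N + N' = n * h := by
    rw [← he, ← hc, ← Equiv.sum_comp Fin.revPerm c, ← Finset.sum_add_distrib]
    simp [hdual]
  have he' : ∑ i, (e i : ℤ) = N := by exact_mod_cast he
  have hc' : ∑ i, (c i : ℤ) = N' := by exact_mod_cast hc
  set D := (firstIdx n r).disjSum (firstIdx n (n - r)) with hD
  have hDcard : D.card = n := by
    rw [hD, Finset.card_disjSum, card_firstIdx hr, card_firstIdx (Nat.sub_le _ _)]
    omega
  set w : Fin n ⊕ Fin n → ℤ := Sum.elim (fun i => -(c i : ℤ)) (fun i => (e i : ℤ)) with hw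
  have hwD : ∑ x ∈ D, w x = N - r * h := by
    rw [hD, Finset.sum_disjSum, ← he', ← sum_exponents_sub_sum_coexponents hr hdual]
    simp only [hw, Sum.elim_inl, Sum.elim_inr, Finset.sum_neg_distrib]
    ring
  have hdeg : ∀ (J : Finset (Fin n)) (K : Finset (Fin n ⊕ Fin n)),
      basisDegree e c K.toLeft J K.toRight = ∑ j ∈ J, (c j : ℤ) + ∑ x ∈ K, w x := by
    intro J K
    rw [Finset.sum_sum_eq_sum_toLeft_add_sum_toRight]
    simp only [hw, Sum.elim_inl, Sum.elim_inr, Finset.sum_neg_distrib, basisDegree]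
    ring
  rw [sum_basisIndex (basisDegree e c)]
  simp_rw [← hD, hdeg, Finset.sum_add_distrib, Finset.sum_const, sum_powersetCard_sum, hwD]
  rw [← Finset.smul_sum, sum_powersetCard_sum, hc', Finset.card_powersetCard,
    Finset.card_powersetCard, Finset.card_univ, Fintype.card_fin, hDcard]
  -- For `n = 0` the truncated difference `n - 1` is not the predecessor of `n`.
  rcases Nat.eq_zero_or_pos n with rfl | hn
  · obtain rfl : r = 0 := by omega
    have hN0 : N = 0 ∧ N' = 0 := by omega
    simp [hN0.1, hN0.2]
  · have h1 : (n.choose k : ℤ) = (n - 1).choose k + choosePred (n - 1) k := by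
      exact_mod_cast choose_eq_choose_add_choosePred hn k
    have h2 : (n.choose r : ℤ) = (n - 1).choose r + choosePred (n - 1) r := by
      exact_mod_cast choose_eq_choose_add_choosePred hn r
    have h3 : (r : ℤ) * n.choose r = n * choosePred (n - 1) r := by
      exact_mod_cast mul_choose_eq_mul_choosePred hn r
    have hN' : (N : ℤ) + N' = n * h := by exact_mod_cast hN
    simp only [nsmul_eq_mul]
    push_cast
    linear_combination (choosePred (n - 1) r * N' : ℤ) * h1 + (choosePred (n - 1) k * N : ℤ) * h2 -
      (choosePred (n - 1) k * h : ℤ) * h3 + (choosePred (n - 1) k * choosePred (n - 1) r : ℤ) * hN'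

/-! ### The product formula near `q = 1` -/

lemma coeff_prod_one_add_C_mul_X {α R : Type*} [DecidableEq α] [CommSemiring R] (s : Finset α)
    (y : α → R) (k : ℕ) :
    (∏ x ∈ s, (1 + Polynomial.C (y x) * Polynomial.X)).coeff k =
      ∑ K ∈ s.powersetCard k, ∏ x ∈ K, y x := by
  rw [Finset.prod_one_add, Polynomial.finsetSum_coeff, Finset.powersetCard_eq_filter,
    Finset.sum_filter]
  refine Finset.sum_congr rfl fun K _ => ?_
  rw [Finset.prod_mul_distrib, Finset.prod_const, ← map_prod, Polynomial.coeff_C_mul_X_pow]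
  simp only [eq_comm]

/-- Expanding the product formula gives one power of `q` for each triple `(I, J, L)`. -/
lemma coeff_formulaNumerator {n : ℕ} (e c : Fin n → ℕ) (k r : ℕ) {q : ℝ} (hq : q ≠ 0) :
    (formulaNumerator e c r q).coeff k =
      ∑ T ∈ basisIndex n k r, q ^ basisDegree e c T.1 T.2.1 T.2.2 := by
  have hprod : (∏ i ∈ firstIdx n r, (1 + Polynomial.C ((q ^ c i)⁻¹) * Polynomial.X)) *
      ∏ i ∈ firstIdx n (n - r), (1 + Polynomial.C (q ^ e i) * Polynomial.X) =
      ∏ x ∈ (firstIdx n r).disjSum (firstIdx n (n - r)), (1 + Polynomial.C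
        (Sum.elim (fun i => (q ^ c i)⁻¹) (fun i => q ^ e i) x) * Polynomial.X) := by
    rw [Finset.prod_disjSum]
    simp only [Sum.elim_inl, Sum.elim_inr]
  rw [formulaNumerator, mul_assoc, hprod, Polynomial.coeff_C_mul, coeff_prod_one_add_C_mul_X, sigma,
    Finset.sum_mul, sum_basisIndex fun I J L => q ^ basisDegree e c I J L]
  refine Finset.sum_congr rfl fun J _ => ?_
  rw [Finset.mul_sum]
  refine Finset.sum_congr rfl fun K _ => ?_
  rw [Finset.prod_sum_eq_prod_toLeft_mul_prod_toRight]
  simp only [Sum.elim_inl, Sum.elim_inr, basisDegree]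
  rw [zpow_sub₀ hq, zpow_add₀ hq, Finset.prod_inv_distrib, Finset.prod_pow_eq_pow_sum,
    Finset.prod_pow_eq_pow_sum, Finset.prod_pow_eq_pow_sum, ← Nat.cast_sum, ← Nat.cast_sum,
    ← Nat.cast_sum, zpow_natCast, zpow_natCast, zpow_natCast]
  field_simp

lemma formulaCoeff_div_hilbInvRing {n : ℕ} (e c : Fin n → ℕ) (k r : ℕ) {q : ℝ} (hq : 0 < q)
    (hq1 : q ≠ 1) : formulaCoeff e c k r q / hilbInvRing e q =
      ∑ T ∈ basisIndex n k r, q ^ basisDegree e c T.1 T.2.1 T.2.2 := by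
  have h : ∏ i, (1 - q ^ (e i + 1)) ≠ 0 := Finset.prod_ne_zero_iff.2 fun i _ => by
    rw [sub_ne_zero]
    exact fun h => hq1 ((pow_eq_one_iff_of_nonneg hq.le (Nat.succ_ne_zero _)).1 h.symm)
  rw [← coeff_formulaNumerator e c k r hq.ne', formulaCoeff, hilbInvRing]
  field_simp

lemma tendsto_deriv_formulaCoeff {n : ℕ} (e c : Fin n → ℕ) (k r : ℕ) :
    Filter.Tendsto (deriv fun q : ℝ => formulaCoeff e c k r q / hilbInvRing e q)
      (nhdsWithin 1 {1}ᶜ)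
      (nhds ((∑ T ∈ basisIndex n k r, basisDegree e c T.1 T.2.1 T.2.2 : ℤ) : ℝ)) := by
  have h1 : Filter.Tendsto (fun q : ℝ => ∑ T ∈ basisIndex n k r,
      (basisDegree e c T.1 T.2.1 T.2.2 : ℝ) * q ^ (basisDegree e c T.1 T.2.1 T.2.2 - 1))
      (nhdsWithin 1 {1}ᶜ)
      (nhds ((∑ T ∈ basisIndex n k r, basisDegree e c T.1 T.2.1 T.2.2 : ℤ) : ℝ)) := by
    have : ((∑ T ∈ basisIndex n k r, basisDegree e c T.1 T.2.1 T.2.2 : ℤ) : ℝ) =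
        ∑ T ∈ basisIndex n k r, (basisDegree e c T.1 T.2.1 T.2.2 : ℝ) *
          (1 : ℝ) ^ (basisDegree e c T.1 T.2.1 T.2.2 - 1) := by
      simp
    rw [this]
    refine tendsto_finsetSum _ fun T _ => Filter.Tendsto.const_mul _ ?_
    exact (continuousAt_zpow₀ (1 : ℝ) _ (Or.inl one_ne_zero)).tendsto.mono_left nhdsWithin_le_nhds
  refine h1.congr' ?_
  have hpos : ∀ᶠ q : ℝ in nhdsWithin 1 {1}ᶜ, 0 < q :=
    nhdsWithin_le_nhds (lt_mem_nhds one_pos)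
  filter_upwards [hpos, self_mem_nhdsWithin] with q hq hq1
  have h2 : (fun q : ℝ => formulaCoeff e c k r q / hilbInvRing e q) =ᶠ[nhds q]
      fun q => ∑ T ∈ basisIndex n k r, q ^ basisDegree e c T.1 T.2.1 T.2.2 := by
    filter_upwards [lt_mem_nhds hq, isOpen_ne.mem_nhds hq1] with p hp hp1
    exact formulaCoeff_div_hilbInvRing e c k r hp hp1
  rw [h2.deriv_eq]
  exact (HasDerivAt.fun_sum fun T _ =>
    hasDerivAt_zpow (basisDegree e c T.1 T.2.1 T.2.2) q (Or.inl hq.ne')).deriv.symm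

end ReflInv

end

theorem proposition6p2 {n : ℕ} (W : Subgroup (ReflInv.GLV n)) (hW : ReflInv.IsReflectionGroup W)
    (k r : ℕ) :
    ∃ ψ : ℕ,
      ReflInv.SumOfUExponentsIs W (ReflInv.mixedRep W k r) ψ ∧
      ψ = ReflInv.choosePred (n - 1) k * (n - 1).choose r * ReflInv.numReflections W +
          (n - 1).choose k * ReflInv.choosePred (n - 1) r * ReflInv.numHyperplanes W ∧
      ((ReflInv.stdRep W).IsIrreducible → k ≤ n → r ≤ n →
        ∀ e c : Fin n → ℕ, ReflInv.IsDualityGroup W e c →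
          Filter.Tendsto
            (deriv fun q : ℝ => ReflInv.formulaCoeff e c k r q / ReflInv.hilbInvRing e q)
            (nhdsWithin 1 {1}ᶜ) (nhds (ψ : ℝ)) ∧
          (∀ (f : Fin n → ReflInv.S n) (θ : Fin n → TensorProduct ℂ (ReflInv.S n) (ReflInv.V n)),
            ReflInv.IsBasicInvariants W f (fun i => e i + 1) →
            ReflInv.IsBasicDerivations W θ c →
            ∀ T ∈ ReflInv.basisIndex n k r,
              ReflInv.IsHomogeneousOmega k r (ReflInv.basisDegree e c T.1 T.2.1 T.2.2)
                (ReflInv.basisElement f θ T.1 T.2.1 T.2.2)) ∧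
          ∑ T ∈ ReflInv.basisIndex n k r, ReflInv.basisDegree e c T.1 T.2.1 T.2.2 = (ψ : ℤ)) := by
  have hfin := hW.1
  have hfintype := Fintype.ofFinite W
  refine ⟨_, ReflInv.sumOfUExponentsIs_mixedRep hW k r, rfl, fun _ _ hr e c hdual => ?_⟩
  obtain ⟨-, ⟨-, f, hf⟩, hc, hdual⟩ := hdual
  have hsum := ReflInv.sum_basisDegree (k := k) hr hdual hf.sum_exponents
    (ReflInv.sum_coexponents hc)
  refine ⟨?_, fun f θ hf hθ T hT => ?_, hsum⟩
  · have h := ReflInv.tendsto_deriv_formulaCoeff e c k r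
    rwa [hsum, Int.cast_natCast] at h
  · have hT' := (Finset.mem_filter.1 hT).2
    have h := ReflInv.isHomogeneousOmega_basisElement hf.1 hθ.2 T.1 T.2.1 T.2.2
    rwa [hT'.2.2.1, hT'.2.2.2] at h
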